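/- All spaces are real and all maps linear. A separable Banach space $\mathbb{G}$ is a \emph{Gurarij space} if for all finite-dimensional normed spaces $E\subseteq F$, every linear isometric embedding $\phi:E\to\mathbb{G}$ and every $\varepsilon>0$ there is an injective linear extension $\bar\phi:F\to\mathbb{G}$ of $\phi$ with $(1-\varepsilon)\|x\|\le\|\bar\phi(x)\|\le(1+\varepsilon)\|x\|$ for all $x\in F$. A \emph{contractive projection} $P:X\to Y$ onto a linear subspace $Y\subseteq X$ is a linear map of norm at most $1$ with $P(X)\subseteq Y$ and $P(y)=y$ for $y\in Y$ (so $\|P\|=1$ unless $Y=0$). A seminorm $S$ on $X$ is \emph{compatible} with it if $S(x)=\operatorname{dist}(x,Y)$ for all $x\in X$. Given seminorms $S$ on $X$ and $T$ on $Z$ and $\varepsilon\ge 0$, a linear map $\phi:X\to Z$ is an \emph{$\varepsilon$-morphism} $(S,X)\to(T,Z)$ if for all $x\in X$ $$(1-\varepsilon)\|x\|\le\|\phi(x)\|\le(1+\varepsilon)\|x\|\quad\text{and}\quad |S(x)-T(\phi(x))|\le\varepsilon\, S(x).$$ \textbf{Theorem.} A Gurarij space exists. Moreover, for every Gurarij space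 $\mathbb{G}$ there exist a linear subspace $\mathbb{H}\subseteq\mathbb{G}$ and a projection $P$ of $\mathbb{G}$ onto $\mathbb{H}$ with $\|P\|=1$ such that, with $S_{\mathbb{G}}^{\mathbb{H}}=\operatorname{dist}(\cdot,\mathbb{H})$, the following hold. (1) Let $E\subseteq F$ be finite-dimensional normed spaces, let $P_E:E\to E_0$ and $P_F:F\to F_0$ be contractive projections onto subspaces such that $P_F$ extends $P_E$, and let $S_E$, $S_F$ be compatible seminorms on $E$ and $F$ such that $S_F$ extends $S_E$. Then for every $\varepsilon>0$ and every $0$-morphism $\phi:(S_E,E)\to(S_{\mathbb{G}}^{\mathbb{H}},\mathbb{G})$ with $\phi\circ P_E=P\circ\phi$ there is an injective $\varepsilon$-morphism $\bar\phi:(S_F,F)\to(S_{\mathbb{G}}^{\mathbb{H}},\mathbb{G})$ that extends $\phi$ and satisfies $\bar\phi\circ P_F=P\circ\bar\phi$. (2) For every separable Banach space $X$ with a contractive projection $p:X\to X_0$ onto a subspace $X_0$ there is a linear isometric embedding $\phi:X\to\mathbb{G}$ such that $\operatorname{dist}(x,X_0)=\operatorname{dist}(\phi(x),\mathbb{H})$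 and $P(\phi(x))=\phi(p(x))$ for all $x\in X$. -/

import Mathlib

universe u

/-- The seminorm `S_X^Y = dist(·, Y)` on a real normed space `X` with a linear subspace `Y`. -/
noncomputable def distSeminorm {X : Type*} [NormedAddCommGroup X] [NormedSpace ℝ X]
    (Y : Submodule ℝ X) : Seminorm ℝ X :=
  Seminorm.of (fun x => Metric.infDist x (Y : Set X))
    (by
      have key : ∀ x : X, Metric.infDist x (Y : Set X) = ‖(Submodule.Quotient.mk x : X ⧸ Y)‖ :=
        fun x => (QuotientAddGroup.norm_mk (S := Y.toAddSubgroup) x).symm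
      intro x y
      simp only [key, Submodule.Quotient.mk_add]
      exact norm_add_le _ _)
    (by
      have key : ∀ x : X, Metric.infDist x (Y : Set X) = ‖(Submodule.Quotient.mk x : X ⧸ Y)‖ :=
        fun x => (QuotientAddGroup.norm_mk (S := Y.toAddSubgroup) x).symm
      have le : ∀ (a : ℝ) (x : X), Metric.infDist (a • x) (Y : Set X) ≤
          ‖a‖ * Metric.infDist x (Y : Set X) := by
        intro a x
        simp only [key, Submodule.Quotient.mk_smul]
        exact norm_smul_le _ _
      intro a x
      refine le_antisymm (le a x) ?_
      rcases eq_or_ne a 0 with rfl | ha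
      · simpa using Metric.infDist_nonneg
      · have h := le a⁻¹ (a • x)
        rw [inv_smul_smul₀ ha, norm_inv] at h
        have ha' : 0 < ‖a‖ := norm_pos_iff.mpr ha
        calc ‖a‖ * Metric.infDist x (Y : Set X)
            ≤ ‖a‖ * (‖a‖⁻¹ * Metric.infDist (a • x) (Y : Set X)) := by gcongr
          _ = Metric.infDist (a • x) (Y : Set X) := by
            rw [← mul_assoc, mul_inv_cancel₀ ha'.ne', one_mul])

/-- `φ` is a linear `ε`-isometry. -/
def IsEpsIsometry {X Y : Type*} [NormedAddCommGroup X] [NormedSpace ℝ X]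
    [NormedAddCommGroup Y] [NormedSpace ℝ Y] (ε : ℝ) (φ : X →ₗ[ℝ] Y) : Prop :=
  ∀ x : X, (1 - ε) * ‖x‖ ≤ ‖φ x‖ ∧ ‖φ x‖ ≤ (1 + ε) * ‖x‖

/-- `φ : (S, X) → (T, Y)` is an `ε`-morphism: an `ε`-isometry for the norms and for the
seminorms. -/
structure IsEpsMorphism {X Y : Type*} [NormedAddCommGroup X] [NormedSpace ℝ X]
    [NormedAddCommGroup Y] [NormedSpace ℝ Y] (S : Seminorm ℝ X) (T : Seminorm ℝ Y)
    (ε : ℝ) (φ : X →ₗ[ℝ] Y) : Prop where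
  isometry : IsEpsIsometry ε φ
  seminorm : ∀ x : X, |S x - T (φ x)| ≤ ε * S x

/-- A separable real Banach space `G` is Gurarij if for all finite dimensional spaces `E ⊆ F`
(the inclusion being a linear isometric embedding `ι`), every linear isometric embedding
`E → G` extends, for each `ε > 0`, to an injective linear `ε`-isometry `F → G`. -/
structure IsGurarij (G : Type u) [NormedAddCommGroup G] [NormedSpace ℝ G] : Prop where
  complete : CompleteSpace G
  separable : TopologicalSpace.SeparableSpace G
  extension : ∀ (E F : Type u) [NormedAddCommGroup E] [NormedSpace ℝ E] [FiniteDimensional ℝ E]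
    [NormedAddCommGroup F] [NormedSpace ℝ F] [FiniteDimensional ℝ F]
    (ι : E →ₗᵢ[ℝ] F) (φ : E →ₗᵢ[ℝ] G) (ε : ℝ), 0 < ε →
    ∃ ψ : F →ₗ[ℝ] G, Function.Injective ψ ∧ (∀ x : E, ψ (ι x) = φ x) ∧ IsEpsIsometry ε ψ

/-- `P` is a linear projection of `X` onto its subspace `Y`, of norm at most one. Unless
`Y = 0`, its norm is then exactly one. -/
structure IsContractiveProjection {X : Type*} [NormedAddCommGroup X] [NormedSpace ℝ X]
    (P : X →L[ℝ] X) (Y : Submodule ℝ X) : Prop where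
  norm_le : ‖P‖ ≤ 1
  mem : ∀ x : X, P x ∈ Y
  fix : ∀ y ∈ Y, P y = y

/-- The seminorm `S` on `X` is compatible with a norm one projection onto `Y`: it is the
distance to `Y` (in particular it is `1`-Lipschitz). -/
def CompatibleSeminorm {X : Type*} [NormedAddCommGroup X] [NormedSpace ℝ X]
    (Y : Submodule ℝ X) (S : Seminorm ℝ X) : Prop :=
  ∀ x : X, S x = Metric.infDist x (Y : Set X)

-- The distance to the range of a projection is awkward to amalgamate directly. It is replaced by a
-- pair of seminorms `N`, `S` attached to an idempotent `p`, keeping only `S ∘ p = 0`, `S ≤ N` and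
-- `N (x - p x) ≤ 2 * S x`. A contractive projection with the distance to its range satisfies these
-- axioms (`ProjStr.ofProjection`), and they survive pullbacks, sums and quotients. So two pairs
-- that agree up to an error on a common part have an amalgam: the infimum of a sum of three terms.
-- It keeps both pairs exactly and places the two copies of the common part within the error of each
-- other.
--
-- Every finite-dimensional space with an idempotent is a retract of the finitely supported
-- sequences in the plane (`ProjStr.exists_coordinates`), and pairs depending on finitely many
-- coordinates form a separable space. A Fraïssé-type construction therefore amalgamates countably
-- many requirements, each met again and again, into one generic pair (`PlaneSeq.exists_isGeneric`).
-- Genericity makes `S` the distance again: a two-dimensional pair in which the distance is attained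
-- can be adjoined over any vector (`PlaneSeq.IsGeneric.exists_N_sub_le`). In the completion,
-- approximate extensions can be corrected to be exact on the given subspace. The result is
-- `HasExtensions`, from which everything else follows.
--
-- Property (1) is a special case, the factor 2 in the axioms turning an absolute error for the
-- seminorm into one relative to it. Property (2) comes from approximate embeddings of an increasing
-- sequence of invariant finite-dimensional subspaces, each amalgamated with its predecessor. The
-- completion is a Gurarij space because a normed space without projection generates freely one with
-- a projection. Finally, any two Gurarij spaces are isometric by back-and-forth
-- (`IsGurarij.nonempty_linearIsometryEquiv`), so the projection can be transported to an arbitrary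
-- one.

universe v w

open Filter Topology

/-! ### Pairs of seminorms attached to an idempotent. -/

/-- A pair of seminorms adapted to a linear idempotent `p`: `N` plays the role of a norm for which
`p` is contractive, `S` that of the distance to the range of `p`. -/
structure ProjStr {V : Type*} [AddCommGroup V] [Module ℝ V] (p : V →ₗ[ℝ] V) where
  N : Seminorm ℝ V
  S : Seminorm ℝ V
  idem : ∀ x, p (p x) = p x
  N_map : ∀ x, N (p x) ≤ N x
  S_map : ∀ x, S (p x) = 0
  S_le : ∀ x, S x ≤ N x
  N_le : ∀ x, N (x - p x) ≤ 2 * S x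

namespace ProjStr

section Basic

variable {V W : Type*} [AddCommGroup V] [Module ℝ V] [AddCommGroup W] [Module ℝ W]
  {p : V →ₗ[ℝ] V} {q : W →ₗ[ℝ] W}

theorem S_sub_map (X : ProjStr p) (x : V) : X.S (x - p x) = X.S x := by
  apply le_antisymm
  · have := map_sub_le_add X.S x (p x)
    rwa [X.S_map, add_zero] at this
  · have := map_add_le_add X.S (x - p x) (p x)
    rwa [X.S_map, add_zero, sub_add_cancel] at this

theorem S_le_N_sub (X : ProjStr p) (x : V) : X.S x ≤ X.N (x - p x) := by
  rw [← X.S_sub_map]; exact X.S_le _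

/-- Pull back along a linear map that commutes with the idempotents. -/
def comap (X : ProjStr q) (f : V →ₗ[ℝ] W) (hp : ∀ x, p (p x) = p x)
    (hf : ∀ x, f (p x) = q (f x)) : ProjStr p where
  N := X.N.comp f
  S := X.S.comp f
  idem := hp
  N_map x := by simpa [hf] using X.N_map (f x)
  S_map x := by simpa [hf] using X.S_map (f x)
  S_le x := X.S_le (f x)
  N_le x := by simpa [hf] using X.N_le (f x)

@[simp] theorem comap_N (X : ProjStr q) (f : V →ₗ[ℝ] W) (hp : ∀ x, p (p x) = p x)
    (hf : ∀ x, f (p x) = q (f x)) (x : V) : (X.comap f hp hf).N x = X.N (f x) := rfl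

/-- The sum of two structures. -/
def add (X Y : ProjStr p) : ProjStr p where
  N := X.N + Y.N
  S := X.S + Y.S
  idem := X.idem
  N_map x := add_le_add (X.N_map x) (Y.N_map x)
  S_map x := by simp [X.S_map, Y.S_map]
  S_le x := add_le_add (X.S_le x) (Y.S_le x)
  N_le x := by
    have := X.N_le x
    have := Y.N_le x
    simp only [_root_.add_apply]
    linarith

/-- Nonnegative multiples of a structure. -/
def smul (c : NNReal) (X : ProjStr p) : ProjStr p where
  N := c • X.N
  S := c • X.S
  idem := X.idem
  N_map x := mul_le_mul_of_nonneg_left (X.N_map x) c.2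
  S_map x := by simp [X.S_map]
  S_le x := mul_le_mul_of_nonneg_left (X.S_le x) c.2
  N_le x := by
    have := mul_le_mul_of_nonneg_left (X.N_le x) c.2
    change (c : ℝ) * X.N (x - p x) ≤ 2 * ((c : ℝ) * X.S x)
    change (c : ℝ) * X.N (x - p x) ≤ (c : ℝ) * (2 * X.S x) at this
    linarith

/-- The zero structure. -/
def zero (hp : ∀ x, p (p x) = p x) : ProjStr p where
  N := 0
  S := 0
  idem := hp
  N_map _ := le_rfl
  S_map _ := rfl
  S_le _ := le_rfl
  N_le _ := by simp

/-- A seminorm as a structure for the identity. -/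
def ofSeminorm (N : Seminorm ℝ V) : ProjStr (LinearMap.id : V →ₗ[ℝ] V) where
  N := N
  S := 0
  idem _ := rfl
  N_map _ := le_rfl
  S_map _ := rfl
  S_le x := apply_nonneg N x
  N_le _ := by simp

end Basic

end ProjStr

/-! ### Quotient seminorms and amalgamation with error. -/

namespace Seminorm

variable {V E : Type*} [AddCommGroup V] [Module ℝ V] [AddCommGroup E] [Module ℝ E]

theorem bddBelow_range_prodMk (M : Seminorm ℝ (V × E)) (y : V) :
    BddBelow (Set.range fun e : E => M (y, e)) :=
  ⟨0, by rintro _ ⟨e, rfl⟩; exact apply_nonneg M _⟩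

/-- The quotient seminorm of a seminorm on a product along the first projection. -/
noncomputable def marginal (M : Seminorm ℝ (V × E)) : Seminorm ℝ V :=
  Seminorm.ofSMulLE (fun y => ⨅ e : E, M (y, e))
    (le_antisymm (by
      refine (ciInf_le (M.bddBelow_range_prodMk 0) 0).trans ?_
      rw [Prod.mk_zero_zero, map_zero]) (Real.iInf_nonneg fun e => apply_nonneg M _))
    (fun x y => by
      refine le_ciInf_add_ciInf fun e e' => ?_
      refine (ciInf_le (M.bddBelow_range_prodMk _) (e + e')).trans ?_
      exact map_add_le_add M (x, e) (y, e'))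
    (fun r x => by
      rw [Real.mul_iInf_of_nonneg (norm_nonneg r)]
      refine le_ciInf fun e => ?_
      refine (ciInf_le (M.bddBelow_range_prodMk _) (r • e)).trans ?_
      exact (map_smul_eq_mul M r (x, e)).le)

theorem marginal_le (M : Seminorm ℝ (V × E)) (y : V) (e : E) : M.marginal y ≤ M (y, e) :=
  ciInf_le (M.bddBelow_range_prodMk y) e

theorem le_marginal (M : Seminorm ℝ (V × E)) {y : V} {a : ℝ} (h : ∀ e, a ≤ M (y, e)) :
    a ≤ M.marginal y :=
  le_ciInf h

end Seminorm

namespace ProjStr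

section Amalgam

variable {V E : Type*} [AddCommGroup V] [Module ℝ V] [AddCommGroup E] [Module ℝ E]
  {p : V →ₗ[ℝ] V} {q : E →ₗ[ℝ] E}

/-- The quotient structure of a structure on a product along the first projection. -/
noncomputable def marginal (M : ProjStr (p.prodMap q)) : ProjStr p where
  N := M.N.marginal
  S := M.S.marginal
  idem x := congrArg Prod.fst (M.idem (x, 0))
  N_map x := M.N.le_marginal fun e => (M.N.marginal_le _ (q e)).trans (M.N_map (x, e))
  S_map x := le_antisymm ((M.S.marginal_le _ (q 0)).trans (M.S_map (x, 0)).le) (apply_nonneg _ _)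
  S_le x := M.N.le_marginal fun e => (M.S.marginal_le _ e).trans (M.S_le _)
  -- The bound is divided by 2 so that the infimum stands alone on one side; `e - q e` is the
  -- competitor above `x - p x`.
  N_le x := by
    rw [mul_comm, ← div_le_iff₀ two_pos]
    refine M.S.le_marginal fun e => ?_
    rw [div_le_iff₀ two_pos, mul_comm]
    exact (M.N.marginal_le _ (e - q e)).trans (M.N_le (x, e))

variable {X F : Type*} [AddCommGroup X] [Module ℝ X] [AddCommGroup F] [Module ℝ F]
  {pX : X →ₗ[ℝ] X} {pF : F →ₗ[ℝ] F}

/-- `φ : E → X` and `ι : E → F` agree, as far as the structures on `X` and `F` are concerned, up to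
an error controlled by a structure on `E`. -/
structure Close (A : ProjStr pX) (B : ProjStr pF) (c : ProjStr q) (φ : E →ₗ[ℝ] X)
    (ι : E →ₗ[ℝ] F) : Prop where
  left : ∀ e, φ (q e) = pX (φ e)
  right : ∀ e, ι (q e) = pF (ι e)
  N : ∀ e, |A.N (φ e) - B.N (ι e)| ≤ c.N e
  S : ∀ e, |A.S (φ e) - B.S (ι e)| ≤ c.S e

variable {A : ProjStr pX} {B : ProjStr pF} {c : ProjStr q} {φ : E →ₗ[ℝ] X} {ι : E →ₗ[ℝ] F}

/-- The sum of the structures whose marginal is the amalgam. -/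
noncomputable def preAmalgam (h : Close A B c φ ι) : ProjStr ((pX.prodMap pF).prodMap q) :=
  have hp : ∀ x : (X × F) × E, ((pX.prodMap pF).prodMap q) (((pX.prodMap pF).prodMap q) x) =
      ((pX.prodMap pF).prodMap q) x := fun x => by
    ext <;> simp [A.idem, B.idem, c.idem]
  ((A.comap (LinearMap.fst ℝ X F ∘ₗ LinearMap.fst ℝ (X × F) E + φ ∘ₗ LinearMap.snd ℝ (X × F) E)
      hp (fun x => by simp [h.left])).add
    (B.comap (LinearMap.snd ℝ X F ∘ₗ LinearMap.fst ℝ (X × F) E - ι ∘ₗ LinearMap.snd ℝ (X × F) E)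
      hp (fun x => by simp [h.right]))).add
    (c.comap (LinearMap.snd ℝ (X × F) E) hp (fun x => by simp))

theorem preAmalgam_N (h : Close A B c φ ι) (x : X) (f : F) (e : E) :
    (preAmalgam h).N ((x, f), e) = A.N (x + φ e) + B.N (f - ι e) + c.N e := rfl

theorem preAmalgam_S (h : Close A B c φ ι) (x : X) (f : F) (e : E) :
    (preAmalgam h).S ((x, f), e) = A.S (x + φ e) + B.S (f - ι e) + c.S e := rfl

/-- The amalgam of two structures along a pair of maps that agree up to an error. -/
noncomputable def amalgam (h : Close A B c φ ι) : ProjStr (pX.prodMap pF) := (preAmalgam h).marginal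

theorem amalgam_N_le (h : Close A B c φ ι) (x : X) (f : F) (e : E) :
    (amalgam h).N (x, f) ≤ A.N (x + φ e) + B.N (f - ι e) + c.N e :=
  (preAmalgam h).N.marginal_le (x, f) e

theorem amalgam_S_le (h : Close A B c φ ι) (x : X) (f : F) (e : E) :
    (amalgam h).S (x, f) ≤ A.S (x + φ e) + B.S (f - ι e) + c.S e :=
  (preAmalgam h).S.marginal_le (x, f) e

/-- Moving `e` from one side to the other never pays: `A.N (φ e)` is at most `B.N (ι e) + c.N e`, so
the last two terms of the sum compensate for the change from `x` to `x + φ e`. -/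
theorem amalgam_N_left (h : Close A B c φ ι) (x : X) : (amalgam h).N (x, 0) = A.N x := by
  refine le_antisymm (by simpa using amalgam_N_le h x 0 0) ?_
  refine (preAmalgam h).N.le_marginal fun e => ?_
  rw [preAmalgam_N, zero_sub, map_neg_eq_map]
  have h1 := (abs_le.1 (h.N e)).2
  have h2 := map_sub_le_add A.N (x + φ e) (φ e)
  rw [add_sub_cancel_right] at h2
  linarith

theorem amalgam_S_left (h : Close A B c φ ι) (x : X) : (amalgam h).S (x, 0) = A.S x := by
  refine le_antisymm (by simpa using amalgam_S_le h x 0 0) ?_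
  refine (preAmalgam h).S.le_marginal fun e => ?_
  rw [preAmalgam_S, zero_sub, map_neg_eq_map]
  have h1 := (abs_le.1 (h.S e)).2
  have h2 := map_sub_le_add A.S (x + φ e) (φ e)
  rw [add_sub_cancel_right] at h2
  linarith

theorem amalgam_N_right (h : Close A B c φ ι) (f : F) : (amalgam h).N (0, f) = B.N f := by
  refine le_antisymm (by simpa using amalgam_N_le h 0 f 0) ?_
  refine (preAmalgam h).N.le_marginal fun e => ?_
  rw [preAmalgam_N, zero_add]
  have h1 := (abs_le.1 (h.N e)).1
  have h2 := map_add_le_add B.N (f - ι e) (ι e)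
  rw [sub_add_cancel] at h2
  linarith

theorem amalgam_S_right (h : Close A B c φ ι) (f : F) : (amalgam h).S (0, f) = B.S f := by
  refine le_antisymm (by simpa using amalgam_S_le h 0 f 0) ?_
  refine (preAmalgam h).S.le_marginal fun e => ?_
  rw [preAmalgam_S, zero_add]
  have h1 := (abs_le.1 (h.S e)).1
  have h2 := map_add_le_add B.S (f - ι e) (ι e)
  rw [sub_add_cancel] at h2
  linarith

/-- The competitor `-e` kills the first two terms and leaves only the error. This is how closeness
of two maps is read off an amalgam. -/
theorem amalgam_N_cross (h : Close A B c φ ι) (e : E) :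
    (amalgam h).N (φ e, -ι e) ≤ c.N e := by
  simpa using amalgam_N_le h (φ e) (-ι e) (-e)

end Amalgam

/-! ### The pair of a contractive projection. -/

section Normed

variable {X : Type*} [NormedAddCommGroup X] [NormedSpace ℝ X]

/-- The structure given by a contractive projection, with the distance to its range. -/
noncomputable def ofProjection {P : X →L[ℝ] X} {Y : Submodule ℝ X}
    (h : IsContractiveProjection P Y) : ProjStr (P : X →ₗ[ℝ] X) where
  N := normSeminorm ℝ X
  S := distSeminorm Y
  idem x := h.fix _ (h.mem x)
  N_map x := by simpa using P.le_of_opNorm_le h.norm_le x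
  S_map x := Metric.infDist_zero_of_mem (h.mem x)
  S_le x := by
    change Metric.infDist x (Y : Set X) ≤ ‖x‖
    simpa using Metric.infDist_le_dist_of_mem (x := x) Y.zero_mem
  N_le x := by
    -- For `y` in the range, `x - P x = (x - y) - P (x - y)`, and both terms have norm at most `‖x -
    -- y‖`.
    have : ‖x - P x‖ / 2 ≤ Metric.infDist x (Y : Set X) := by
      refine (Metric.le_infDist ⟨0, Y.zero_mem⟩).2 fun y hy => ?_
      have h1 : ‖P (x - y)‖ ≤ ‖x - y‖ := by simpa using P.le_of_opNorm_le h.norm_le (x - y)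
      rw [map_sub, h.fix y hy] at h1
      have h2 := norm_sub_le (x - y) (P x - y)
      rw [sub_sub_sub_cancel_right] at h2
      rw [dist_eq_norm]
      linarith
    change ‖x - P x‖ ≤ 2 * Metric.infDist x (Y : Set X)
    linarith

@[simp] theorem ofProjection_N {P : X →L[ℝ] X} {Y : Submodule ℝ X}
    (h : IsContractiveProjection P Y) (x : X) : (ofProjection h).N x = ‖x‖ := rfl

end Normed

end ProjStr

theorem Seminorm.continuous_of_finiteDimensional {F : Type*} [NormedAddCommGroup F]
    [NormedSpace ℝ F] [FiniteDimensional ℝ F] (q : Seminorm ℝ F) : Continuous q :=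
  q.convexOn.locallyLipschitz.continuous

theorem Seminorm.exists_le_mul_norm {F : Type*} [NormedAddCommGroup F]
    [NormedSpace ℝ F] [FiniteDimensional ℝ F] (q : Seminorm ℝ F) :
    ∃ C : ℝ, 0 < C ∧ ∀ x, q x ≤ C * ‖x‖ :=
  q.bound_of_continuous_normedSpace q.continuous_of_finiteDimensional

/-! ### Sequences in the plane and pairs on finitely many coordinates. -/

/-- The space of finitely supported sequences of points of the plane. -/
abbrev PlaneSeq : Type := ℕ →₀ ℝ × ℝ

namespace PlaneSeq

/-- The coordinatewise projection to the first axis. -/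
noncomputable def proj : PlaneSeq →ₗ[ℝ] PlaneSeq :=
  Finsupp.mapRange.linearMap (LinearMap.inl ℝ ℝ ℝ ∘ₗ LinearMap.fst ℝ ℝ ℝ)

@[simp] theorem proj_apply (v : PlaneSeq) (i : ℕ) : proj v i = ((v i).1, 0) := rfl

theorem proj_proj (v : PlaneSeq) : proj (proj v) = proj v := by ext i <;> simp

/-- Truncation to the first `n` terms. -/
noncomputable def trunc (n : ℕ) : PlaneSeq →ₗ[ℝ] PlaneSeq where
  toFun v := v.filter (· < n)
  map_add' _ _ := Finsupp.filter_add
  map_smul' _ _ := Finsupp.filter_smul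

theorem trunc_apply (n : ℕ) (v : PlaneSeq) (i : ℕ) : trunc n v i = if i < n then v i else 0 :=
  Finsupp.filter_apply _ _ _

/-- The right shift by `k` places. -/
noncomputable def shift (k : ℕ) : PlaneSeq →ₗ[ℝ] PlaneSeq := Finsupp.lmapDomain (ℝ × ℝ) ℝ (· + k)

theorem shift_apply (k : ℕ) (v : PlaneSeq) (i : ℕ) :
    shift k v i = if k ≤ i then v (i - k) else 0 := by
  split_ifs with h
  · obtain ⟨j, rfl⟩ := Nat.exists_eq_add_of_le' h
    rw [Nat.add_sub_cancel]
    exact Finsupp.mapDomain_apply (add_left_injective k) v j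
  · refine Finsupp.mapDomain_of_notMem_range v i ?_
    rintro ⟨j, rfl⟩
    exact h (Nat.le_add_left k j)

/-- The left shift by `k` places. -/
noncomputable def unshift (k : ℕ) : PlaneSeq →ₗ[ℝ] PlaneSeq :=
  Finsupp.lcomapDomain (· + k) (add_left_injective k)

@[simp] theorem unshift_apply (k : ℕ) (v : PlaneSeq) (i : ℕ) : unshift k v i = v (i + k) := rfl

theorem trunc_proj (n : ℕ) (v : PlaneSeq) : trunc n (proj v) = proj (trunc n v) := by
  refine Finsupp.ext fun i => ?_
  simp only [trunc_apply, proj_apply]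
  split_ifs <;> rfl

theorem shift_proj (k : ℕ) (v : PlaneSeq) : shift k (proj v) = proj (shift k v) := by
  refine Finsupp.ext fun i => ?_
  simp only [shift_apply, proj_apply]
  split_ifs <;> rfl

theorem unshift_proj (k : ℕ) (v : PlaneSeq) : unshift k (proj v) = proj (unshift k v) := by
  refine Finsupp.ext fun i => ?_
  simp

theorem unshift_shift (k : ℕ) (v : PlaneSeq) : unshift k (shift k v) = v := by
  refine Finsupp.ext fun i => ?_
  simp [shift_apply]

theorem trunc_trunc (m n : ℕ) (v : PlaneSeq) : trunc m (trunc n v) = trunc (min m n) v := by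
  refine Finsupp.ext fun i => ?_
  simp only [trunc_apply]
  split_ifs <;> first | rfl | omega

theorem trunc_shift_self (k : ℕ) (v : PlaneSeq) : trunc k (shift k v) = 0 := by
  refine Finsupp.ext fun i => ?_
  simp only [trunc_apply, shift_apply, Finsupp.coe_zero, Pi.zero_apply]
  split_ifs <;> first | rfl | omega

theorem trunc_add_shift (n k : ℕ) (v : PlaneSeq) :
    trunc (n + k) (shift k v) = shift k (trunc n v) := by
  refine Finsupp.ext fun i => ?_
  simp only [trunc_apply, shift_apply]
  split_ifs <;> first | rfl | omega

theorem unshift_trunc (n k : ℕ) (v : PlaneSeq) :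
    unshift k (trunc n v) = trunc (n - k) (unshift k v) := by
  refine Finsupp.ext fun i => ?_
  simp only [trunc_apply, unshift_apply]
  split_ifs <;> first | rfl | omega

theorem trunc_zero (v : PlaneSeq) : trunc 0 v = 0 := by
  refine Finsupp.ext fun i => ?_
  simp [trunc_apply]

theorem trunc_eq_self_of_le {m n : ℕ} (h : m ≤ n) {v : PlaneSeq} (hv : trunc m v = v) :
    trunc n v = v := by
  rw [← hv, trunc_trunc, min_eq_right h]

theorem exists_trunc_eq_self (v : PlaneSeq) : ∃ n, trunc n v = v := by
  refine ⟨v.support.sup id + 1, Finsupp.ext fun i => ?_⟩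
  rw [trunc_apply]
  split_ifs with h
  · rfl
  · by_contra hv
    exact h (Nat.lt_succ_of_le (Finset.le_sup (f := id) (Finsupp.mem_support_iff.2 (Ne.symm hv))))

/-- The `ℓ¹` structure on the first `n` coordinates. -/
noncomputable def ell (n : ℕ) : ProjStr proj where
  N := Seminorm.of (fun v => ∑ i ∈ Finset.range n, ‖v i‖)
    (fun x y => by
      rw [← Finset.sum_add_distrib]
      exact Finset.sum_le_sum fun i _ => norm_add_le _ _)
    (fun a x => by simp only [Finset.mul_sum, Finsupp.smul_apply, norm_smul])
  S := Seminorm.of (fun v => ∑ i ∈ Finset.range n, ‖(v i).2‖)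
    (fun x y => by
      rw [← Finset.sum_add_distrib]
      exact Finset.sum_le_sum fun i _ => norm_add_le _ _)
    (fun a x => by simp only [Finset.mul_sum, Finsupp.smul_apply, Prod.smul_snd, norm_smul])
  idem := proj_proj
  N_map v := by
    change ∑ i ∈ Finset.range n, ‖proj v i‖ ≤ ∑ i ∈ Finset.range n, ‖v i‖
    refine Finset.sum_le_sum fun i _ => ?_
    rw [proj_apply, Prod.norm_def, norm_zero, max_eq_left (norm_nonneg _)]
    exact norm_fst_le (v i)
  S_map v := by
    change ∑ i ∈ Finset.range n, ‖((proj v) i).2‖ = (0 : ℝ)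
    simp
  S_le v := by
    change ∑ i ∈ Finset.range n, ‖(v i).2‖ ≤ ∑ i ∈ Finset.range n, ‖v i‖
    exact Finset.sum_le_sum fun i _ => norm_snd_le (v i)
  N_le v := by
    have h : ∑ i ∈ Finset.range n, ‖(v - proj v) i‖ = ∑ i ∈ Finset.range n, ‖(v i).2‖ :=
      Finset.sum_congr rfl fun i _ => by
        rw [Finsupp.sub_apply, proj_apply, Prod.norm_def]
        simp
    change ∑ i ∈ Finset.range n, ‖(v - proj v) i‖ ≤ 2 * ∑ i ∈ Finset.range n, ‖(v i).2‖
    rw [h]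
    have : 0 ≤ ∑ i ∈ Finset.range n, ‖(v i).2‖ := Finset.sum_nonneg fun i _ => norm_nonneg _
    linarith

theorem ell_N (n : ℕ) (v : PlaneSeq) : (ell n).N v = ∑ i ∈ Finset.range n, ‖v i‖ := rfl

theorem ell_S (n : ℕ) (v : PlaneSeq) : (ell n).S v = ∑ i ∈ Finset.range n, ‖(v i).2‖ := rfl

/-- Estimates for `S` thereby reduce to estimates for `N` at `v - proj v`, which yields errors that
vanish on the range of `proj`. -/
theorem ell_S_eq (n : ℕ) (v : PlaneSeq) : (ell n).S v = (ell n).N (v - proj v) := by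
  rw [ell_S, ell_N]
  refine Finset.sum_congr rfl fun i _ => ?_
  rw [Finsupp.sub_apply, proj_apply, Prod.norm_def]
  simp

theorem ell_N_trunc_le (m n : ℕ) (v : PlaneSeq) : (ell n).N (trunc m v) ≤ (ell m).N v := by
  simp only [ell_N]
  rw [← Finset.sum_filter_add_sum_filter_not (Finset.range n) (· < m)]
  have h1 : ∑ i ∈ Finset.range n with ¬ i < m, ‖trunc m v i‖ = 0 :=
    Finset.sum_eq_zero fun i hi => by
      rw [trunc_apply, if_neg (Finset.mem_filter.1 hi).2, norm_zero]
  rw [h1, add_zero]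
  refine (Finset.sum_le_sum (g := fun i => ‖v i‖) fun i hi => ?_).trans
    (Finset.sum_le_sum_of_subset_of_nonneg ?_ fun i _ _ => norm_nonneg _)
  · rw [trunc_apply, if_pos (Finset.mem_filter.1 hi).2]
  · intro i hi
    exact Finset.mem_range.2 (Finset.mem_filter.1 hi).2

theorem ell_S_trunc_le (m n : ℕ) (v : PlaneSeq) : (ell n).S (trunc m v) ≤ (ell m).S v := by
  rw [ell_S_eq, ell_S_eq, ← trunc_proj, ← map_sub]
  exact ell_N_trunc_le m n _

/-- The structure only depends on the first `n` terms. -/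
def IsLevel (n : ℕ) (X : ProjStr proj) : Prop :=
  ∀ v, X.N (trunc n v) = X.N v ∧ X.S (trunc n v) = X.S v

/-- The point with given first `n` terms. -/
noncomputable def ofFin (n : ℕ) : (Fin n → ℝ × ℝ) →ₗ[ℝ] PlaneSeq :=
  Finsupp.lmapDomain (ℝ × ℝ) ℝ (Fin.val : Fin n → ℕ) ∘ₗ
    (Finsupp.linearEquivFunOnFinite ℝ (ℝ × ℝ) (Fin n)).symm.toLinearMap

theorem ofFin_apply (n : ℕ) (v : PlaneSeq) : ofFin n (fun i => v i) = trunc n v := by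
  refine Finsupp.ext fun i => ?_
  rw [trunc_apply]
  split_ifs with h
  · exact Finsupp.mapDomain_apply Fin.val_injective _ (⟨i, h⟩ : Fin n)
  · refine Finsupp.mapDomain_of_notMem_range _ i ?_
    rintro ⟨j, rfl⟩
    exact h j.2

theorem norm_le_ell (n : ℕ) (v : PlaneSeq) : ‖fun i : Fin n => v i‖ ≤ (ell n).N v := by
  refine (pi_norm_le_iff_of_nonneg (apply_nonneg _ _)).2 fun i => ?_
  exact Finset.single_le_sum (f := fun i => ‖v i‖) (fun i _ => norm_nonneg _)
    (Finset.mem_range.2 i.2)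

theorem abs_sub_le_of_closedBall {F : Type*} [NormedAddCommGroup F] [NormedSpace ℝ F]
    {q r : Seminorm ℝ F} {ε : ℝ} (h : ∀ x ∈ Metric.closedBall (0 : F) 1, |q x - r x| ≤ ε) (x : F) :
    |q x - r x| ≤ ε * ‖x‖ := by
  rcases eq_or_ne x 0 with rfl | hx
  · simp
  have hx' : 0 < ‖x‖ := norm_pos_iff.2 hx
  have h1 := h (‖x‖⁻¹ • x) (by
    rw [mem_closedBall_zero_iff, norm_smul, norm_inv, norm_norm, inv_mul_cancel₀ hx'.ne'])
  rw [map_smul_eq_mul, map_smul_eq_mul, ← mul_sub, abs_mul, norm_inv, norm_norm,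
    abs_of_pos (inv_pos.2 hx'), inv_mul_le_iff₀ hx'] at h1
  linarith

/-- The structures that depend on the first `n` terms form a separable space. -/
theorem exists_dense_isLevel (n : ℕ) : ∃ D : ℕ → ProjStr proj, (∀ j, IsLevel n (D j)) ∧
    ∀ X, IsLevel n X → ∀ ε > 0, ∃ j, ∀ v, |X.N v - (D j).N v| ≤ ε * (ell n).N v ∧
      |X.S v - (D j).S v| ≤ ε * (ell n).S v := by
  let B := Metric.closedBall (0 : Fin n → ℝ × ℝ) 1
  have : CompactSpace B := isCompact_iff_compactSpace.1 (isCompact_closedBall _ _)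
  let Φ : {X : ProjStr proj // IsLevel n X} → C(B, ℝ) × C(B, ℝ) := fun X =>
    (⟨fun x => X.1.N (ofFin n x), ((X.1.N.comp (ofFin n)).continuous_of_finiteDimensional).comp
      continuous_subtype_val⟩,
     ⟨fun x => X.1.S (ofFin n x), ((X.1.S.comp (ofFin n)).continuous_of_finiteDimensional).comp
      continuous_subtype_val⟩)
  have : Nonempty (Set.range Φ) :=
    ⟨⟨_, ⟨⟨ProjStr.zero proj_proj, fun v => ⟨rfl, rfl⟩⟩, rfl⟩⟩⟩
  -- Continuous functions on a compact metric space form a separable metric space, so every subset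
  -- of pairs of them is separable; the dense sequence thus consists of genuine pairs.
  obtain ⟨d, hd⟩ := TopologicalSpace.exists_dense_seq (Set.range Φ)
  choose D hD using fun j => (d j).2
  refine ⟨fun j => (D j).1, fun j => (D j).2, fun X hX ε hε => ?_⟩
  obtain ⟨j, hj⟩ := hd.exists_dist_lt (⟨Φ ⟨X, hX⟩, ⟨_, rfl⟩⟩ : Set.range Φ) hε
  rw [Subtype.dist_eq, ← hD j, Prod.dist_eq, max_lt_iff] at hj
  have hN : ∀ v, |X.N v - (D j).1.N v| ≤ ε * (ell n).N v := fun v => by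
    have h1 := abs_sub_le_of_closedBall (q := X.N.comp (ofFin n))
      (r := (D j).1.N.comp (ofFin n)) (ε := ε)
      (fun x hx => ((ContinuousMap.dist_apply_le_dist (⟨x, hx⟩ : B)).trans_lt hj.1).le)
      (fun i => v i)
    rw [Seminorm.comp_apply, Seminorm.comp_apply, ofFin_apply, (hX v).1, ((D j).2 v).1] at h1
    exact h1.trans (mul_le_mul_of_nonneg_left (norm_le_ell n v) hε.le)
  have hS : ∀ v, |X.S v - (D j).1.S v| ≤ ε * (ell n).N v := fun v => by
    have h1 := abs_sub_le_of_closedBall (q := X.S.comp (ofFin n))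
      (r := (D j).1.S.comp (ofFin n)) (ε := ε)
      (fun x hx => ((ContinuousMap.dist_apply_le_dist (⟨x, hx⟩ : B)).trans_lt hj.2).le)
      (fun i => v i)
    rw [Seminorm.comp_apply, Seminorm.comp_apply, ofFin_apply, (hX v).2, ((D j).2 v).2] at h1
    exact h1.trans (mul_le_mul_of_nonneg_left (norm_le_ell n v) hε.le)
  refine ⟨j, fun v => ⟨hN v, ?_⟩⟩
  -- Replacing `v` by `v - proj v` changes neither value of `S`, but improves the error from `(ell
  -- n).N v` to `(ell n).S v`.
  have := hS (v - proj v)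
  rwa [X.S_sub_map, (D j).1.S_sub_map, ← ell_S_eq] at this

end PlaneSeq

theorem Seminorm.eq_of_sub_eq_zero {V : Type*} [AddCommGroup V] [Module ℝ V] (q : Seminorm ℝ V)
    {x y : V} (h : q (x - y) = 0) : q x = q y := by
  have := abs_sub_map_le_sub q x y
  rw [h] at this
  exact sub_eq_zero.1 (abs_nonpos_iff.1 this)

namespace ProjStr

variable {V : Type*} [AddCommGroup V] [Module ℝ V] {p : V →ₗ[ℝ] V}

theorem S_eq_zero (X : ProjStr p) {x : V} (h : X.N x = 0) : X.S x = 0 :=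
  le_antisymm ((X.S_le x).trans h.le) (apply_nonneg _ _)

theorem eq_of_N_sub_eq_zero (X : ProjStr p) {x y : V} (h : X.N (x - y) = 0) :
    X.N x = X.N y ∧ X.S x = X.S y :=
  ⟨X.N.eq_of_sub_eq_zero h, X.S.eq_of_sub_eq_zero (X.S_eq_zero h)⟩

end ProjStr

/-! ### The generic pair as the union of a tower. -/

namespace PlaneSeq

theorem IsLevel.N_sub_trunc {k n : ℕ} {X : ProjStr proj} (h : IsLevel k X) (hkn : k ≤ n)
    (v : PlaneSeq) : X.N (v - trunc n v) = 0 := by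
  rw [← (h _).1, map_sub, trunc_trunc, min_eq_left hkn, sub_self, map_zero]

theorem IsLevel.mono {k n : ℕ} {X : ProjStr proj} (h : IsLevel k X) (hkn : k ≤ n) :
    IsLevel n X := fun v => by
  have := X.eq_of_N_sub_eq_zero (h.N_sub_trunc hkn v)
  exact ⟨this.1.symm, this.2.symm⟩

/-- A structure that depends on finitely many coordinates. -/
structure Stage where
  X : ProjStr proj
  level : ℕ
  isLevel : IsLevel level X

/-- `t` agrees with `s` on the coordinates of `s`. -/
structure Stage.Extends (s t : Stage) : Prop where
  level_lt : s.level < t.level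
  eq : ∀ v, trunc s.level v = v → t.X.N v = s.X.N v ∧ t.X.S v = s.X.S v

/-- The structures `X` and `Z` are `ε`-close on the first `m` coordinates. -/
def CloseOn (m : ℕ) (ε : ℝ) (X Z : ProjStr proj) : Prop :=
  ∀ v, |X.N (trunc m v) - Z.N (trunc m v)| ≤ ε * (ell m).N v ∧
    |X.S (trunc m v) - Z.S (trunc m v)| ≤ ε * (ell m).S v

theorem CloseOn.close {m : ℕ} {ε : NNReal} {X Z : ProjStr proj} (h : CloseOn m ε X Z) :
    ProjStr.Close X Z ((ell m).smul ε) (trunc m) (trunc m) where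
  left := trunc_proj m
  right := trunc_proj m
  N v := (h v).1
  S v := (h v).2

/-- The stage and `Z` are amalgamated along their first `m` coordinates. The copy of `Z` is stored
in fresh coordinates, beyond the level `k` of the stage, so `ρ` is the shift by `k`. -/
theorem Stage.exists_extends_of_closeOn (s : Stage) {m n : ℕ} {ε : NNReal} {Z : ProjStr proj}
    (hZ : IsLevel n Z) (hm : m ≤ s.level) (h : CloseOn m ε s.X Z) :
    ∃ t : Stage, s.Extends t ∧ ∃ ρ : PlaneSeq →ₗ[ℝ] PlaneSeq,
      (∀ v, ρ (proj v) = proj (ρ v)) ∧ (∀ z, t.X.N (ρ z) = Z.N z ∧ t.X.S (ρ z) = Z.S z) ∧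
      (∀ v, trunc m v = v → t.X.N (v - ρ v) ≤ ε * (ell m).N v) ∧
      ∀ z, trunc n z = z → trunc t.level (ρ z) = ρ z := by
  set k := s.level with hk
  set A := ProjStr.amalgam h.close
  -- The seminorms ignore coordinates beyond their levels; this makes the differences of tails below
  -- harmless.
  have hvan : ∀ v w, s.X.N v = 0 → Z.N w = 0 → A.N (v, w) = 0 := fun v w hv hw => by
    refine le_antisymm ?_ (apply_nonneg _ _)
    have := map_add_le_add A.N (v, 0) (0, w)
    rwa [ProjStr.amalgam_N_left, ProjStr.amalgam_N_right, hv, hw, Prod.mk_add_mk, add_zero,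
      zero_add, add_zero] at this
  have hα : ∀ v, (LinearMap.id.prod (unshift k)) (proj v) =
      (proj.prodMap proj) ((LinearMap.id.prod (unshift k)) v) := fun v =>
    Prod.ext rfl (unshift_proj k v)
  -- No truncation of the first entry is needed, as `s.X` sees only the coordinates below `k`. The
  -- `+ 1` makes the level grow even if `n = 0`.
  refine ⟨⟨A.comap (LinearMap.id.prod (unshift k)) proj_proj hα, k + n + 1, fun v => ?_⟩,
    ⟨by change s.level < k + n + 1; omega, fun v hv => ?_⟩, shift k, shift_proj k,
    fun z => ?_, fun v hv => ?_, fun z hz => ?_⟩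
  · refine A.eq_of_N_sub_eq_zero ?_
    rw [← map_sub]
    refine hvan _ _ ?_ ?_
    · rw [LinearMap.id_apply, map_sub_rev]
      exact s.isLevel.N_sub_trunc (by omega) v
    · rw [map_sub, unshift_trunc, map_sub_rev]
      exact hZ.N_sub_trunc (by omega) _
  · have hu : unshift k v = 0 := by rw [← hv, unshift_trunc, Nat.sub_self, trunc_zero]
    change A.N (v, unshift k v) = _ ∧ A.S (v, unshift k v) = _
    rw [hu]
    exact ⟨ProjStr.amalgam_N_left _ _, ProjStr.amalgam_S_left _ _⟩
  · change A.N (shift k z, unshift k (shift k z)) = _ ∧ A.S (shift k z, unshift k (shift k z)) = _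
    rw [unshift_shift, ← ProjStr.amalgam_N_right h.close, ← ProjStr.amalgam_S_right h.close]
    refine A.eq_of_N_sub_eq_zero ?_
    rw [Prod.mk_sub_mk, sub_self, sub_zero]
    refine hvan _ _ ?_ (map_zero _)
    rw [← (s.isLevel _).1, trunc_shift_self, map_zero]
  · have hu : unshift k v = 0 := by
      rw [← trunc_eq_self_of_le hm hv, unshift_trunc, Nat.sub_self, trunc_zero]
    change A.N (v - shift k v, unshift k (v - shift k v)) ≤ _
    rw [map_sub, hu, unshift_shift, zero_sub]
    have h1 := ProjStr.amalgam_N_cross h.close v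
    rw [hv] at h1
    refine le_trans (le_of_eq (A.eq_of_N_sub_eq_zero ?_).1) h1
    rw [Prod.mk_sub_mk, sub_self, sub_sub_cancel_left]
    refine hvan _ _ ?_ (map_zero _)
    rw [map_neg_eq_map, ← (s.isLevel _).1, trunc_shift_self, map_zero]
  · refine trunc_eq_self_of_le (m := n + k) (by change n + k ≤ k + n + 1; omega) ?_
    rw [trunc_add_shift, hz]

/-- `t` realizes the `n`-coordinate structure `Z`, up to `ε` over the first `m` coordinates. -/
def Stage.Realizes (t : Stage) (m n : ℕ) (ε : ℝ) (Z : ProjStr proj) : Prop :=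
  ∃ ρ : PlaneSeq →ₗ[ℝ] PlaneSeq,
      (∀ v, ρ (proj v) = proj (ρ v)) ∧ (∀ z, t.X.N (ρ z) = Z.N z ∧ t.X.S (ρ z) = Z.S z) ∧
      (∀ v, trunc m v = v → t.X.N (v - ρ v) ≤ ε * (ell m).N v) ∧
      ∀ z, trunc n z = z → trunc t.level (ρ z) = ρ z

/-- A requirement that does not apply is skipped by raising the level alone, so the tower can treat
requirements without checking them first. -/
theorem Stage.exists_extends (s : Stage) (m n : ℕ) (ε : NNReal) (Z : ProjStr proj)
    (hZ : IsLevel n Z) : ∃ t : Stage, s.Extends t ∧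
      (m ≤ s.level → CloseOn m ε s.X Z → t.Realizes m n ε Z) := by
  by_cases h : m ≤ s.level ∧ CloseOn m ε s.X Z
  · obtain ⟨t, h1, h2⟩ := s.exists_extends_of_closeOn hZ h.1 h.2
    exact ⟨t, h1, fun _ _ => h2⟩
  · exact ⟨⟨s.X, s.level + 1, s.isLevel.mono (Nat.le_succ _)⟩, ⟨Nat.lt_succ_self _, fun v _ =>
      ⟨rfl, rfl⟩⟩, fun h1 h2 => (h ⟨h1, h2⟩).elim⟩

/-- A sequence of stages that realizes all requirements from a dense list. -/
theorem exists_tower : ∃ s : ℕ → Stage, (∀ k, (s k).Extends (s (k + 1))) ∧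
    ∀ (m n : ℕ) (Z : ProjStr proj), IsLevel n Z → ∀ ε > (0 : ℝ), ∃ δ > 0, δ ≤ ε ∧ ∀ K,
      ∃ k ≥ K, ∃ Z' : ProjStr proj, (∀ v, |Z.N v - Z'.N v| ≤ δ * (ell n).N v ∧
        |Z.S v - Z'.S v| ≤ δ * (ell n).S v) ∧
        (m ≤ (s k).level → CloseOn m δ (s k).X Z' → (s (k + 1)).Realizes m n δ Z') := by
  choose D hD hdense using exists_dense_isLevel
  let ε : ℕ → NNReal := fun i => 1 / ((i : NNReal) + 1)
  have hnext : ∀ (s : Stage) (r : ((ℕ × ℕ) × (ℕ × ℕ))), ∃ t : Stage, s.Extends t ∧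
      (r.1.1 ≤ s.level → CloseOn r.1.1 (ε r.2.1) s.X (D r.1.2 r.2.2) →
        t.Realizes r.1.1 r.1.2 (ε r.2.1) (D r.1.2 r.2.2)) := fun s r =>
    s.exists_extends _ _ _ _ (hD _ _)
  choose next hext hreal using hnext
  -- The first component of the unpairing names the requirement and the second is free, so each
  -- requirement recurs beyond every bound.
  obtain ⟨req, hreq⟩ : ∃ req : ℕ → ((ℕ × ℕ) × (ℕ × ℕ)), ∀ r K, ∃ k ≥ K, req k = r := by
    refine ⟨fun k => (Denumerable.eqv ((ℕ × ℕ) × (ℕ × ℕ))).symm (Nat.unpair k).1, fun r K =>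
      ⟨Nat.pair (Denumerable.eqv _ r) K, Nat.right_le_pair _ _, ?_⟩⟩
    simp
  let s : ℕ → Stage := fun k => Nat.rec ⟨ProjStr.zero proj_proj, 0, fun v => ⟨rfl, rfl⟩⟩
    (fun k t => next t (req k)) k
  have hs : ∀ k, s (k + 1) = next (s k) (req k) := fun k => rfl
  refine ⟨s, fun k => by rw [hs]; exact hext _ _, fun m n Z hZ η hη => ?_⟩
  obtain ⟨i, hi⟩ := exists_nat_one_div_lt hη
  have hεi : ((ε i : NNReal) : ℝ) = 1 / ((i : ℝ) + 1) := by simp [ε]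
  have hpos : (0 : ℝ) < ε i := by rw [hεi]; exact Nat.one_div_pos_of_nat
  obtain ⟨j, hj⟩ := hdense n Z hZ (ε i) hpos
  refine ⟨ε i, hpos, by rw [hεi]; exact hi.le, fun K => ?_⟩
  obtain ⟨k, hk, hr⟩ := hreq ((m, n), (i, j)) K
  refine ⟨k, hk, D n j, hj, ?_⟩
  have := hreal (s k) (req k)
  rw [← hs, hr] at this
  exact this

/-- A structure on the space of finite sequences that realizes, approximately, all one-step
extensions. -/
def IsGeneric (X : ProjStr proj) : Prop :=
  ∀ (m n : ℕ) (Z : ProjStr proj), m ≤ n → IsLevel n Z →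
    (∀ v, trunc m v = v → X.N v = Z.N v ∧ X.S v = Z.S v) → ∀ ε > (0 : ℝ),
    ∃ ρ : PlaneSeq →ₗ[ℝ] PlaneSeq, (∀ v, ρ (proj v) = proj (ρ v)) ∧
      (∀ z, trunc n z = z → |X.N (ρ z) - Z.N z| ≤ ε * (ell n).N z ∧
        |X.S (ρ z) - Z.S z| ≤ ε * (ell n).S z) ∧
      ∀ v, trunc m v = v → X.N (v - ρ v) ≤ ε * (ell m).N v

theorem exists_isGeneric : ∃ X : ProjStr proj, IsGeneric X := by
  obtain ⟨s, hext, hreal⟩ := exists_tower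
  have hlevel : ∀ k, k ≤ (s k).level := fun k => by
    induction k with
    | zero => exact Nat.zero_le _
    | succ k ih => exact Nat.succ_le_of_lt (ih.trans_lt (hext k).level_lt)
  have hmono : StrictMono fun k => (s k).level := strictMono_nat_of_lt_succ fun k =>
    (hext k).level_lt
  have hstab : ∀ k v, trunc (s k).level v = v → ∀ l ≥ k,
      (s l).X.N v = (s k).X.N v ∧ (s l).X.S v = (s k).X.S v := fun k v hv l hl => by
    induction l, hl using Nat.le_induction with
    | base => exact ⟨rfl, rfl⟩
    | succ l hl ih =>
      have := (hext l).eq v (trunc_eq_self_of_le (hmono.monotone hl) hv)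
      exact ⟨this.1.trans ih.1, this.2.trans ih.2⟩
  -- The limit at `v` is read at stage `κ v`, which already contains all coordinates of `v`; by
  -- `hlim` any other such stage gives the same value.
  choose κ hκ using exists_trunc_eq_self
  have hκ' : ∀ v, trunc (s (κ v)).level v = v := fun v => trunc_eq_self_of_le (hlevel _) (hκ v)
  have hlim : ∀ k v, trunc (s k).level v = v →
      (s (κ v)).X.N v = (s k).X.N v ∧ (s (κ v)).X.S v = (s k).X.S v := fun k v hv => by
    have h1 := hstab k v hv (max k (κ v)) (le_max_left _ _)
    have h2 := hstab (κ v) v (hκ' v) (max k (κ v)) (le_max_right _ _)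
    exact ⟨h2.1.symm.trans h1.1, h2.2.symm.trans h1.2⟩
  have htwo : ∀ v w : PlaneSeq, ∃ k, trunc (s k).level v = v ∧ trunc (s k).level w = w :=
    fun v w => ⟨max (κ v) (κ w),
      trunc_eq_self_of_le ((le_max_left _ _).trans (hlevel _)) (hκ v),
      trunc_eq_self_of_le ((le_max_right _ _).trans (hlevel _)) (hκ w)⟩
  have hpk : ∀ k v, trunc (s k).level v = v → trunc (s k).level (proj v) = proj v :=
    fun k v hv => by rw [trunc_proj, hv]
  let X : ProjStr proj :=
    { N := Seminorm.of (fun v => (s (κ v)).X.N v)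
        (fun v w => by
          obtain ⟨k, hv, hw⟩ := htwo v w
          rw [(hlim k v hv).1, (hlim k w hw).1, (hlim k (v + w) (by rw [map_add, hv, hw])).1]
          exact map_add_le_add _ _ _)
        (fun a v => by
          rw [(hlim _ (a • v) (by rw [map_smul, hκ'])).1]
          exact map_smul_eq_mul _ _ _)
      S := Seminorm.of (fun v => (s (κ v)).X.S v)
        (fun v w => by
          obtain ⟨k, hv, hw⟩ := htwo v w
          rw [(hlim k v hv).2, (hlim k w hw).2, (hlim k (v + w) (by rw [map_add, hv, hw])).2]
          exact map_add_le_add _ _ _)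
        (fun a v => by
          rw [(hlim _ (a • v) (by rw [map_smul, hκ'])).2]
          exact map_smul_eq_mul _ _ _)
      idem := proj_proj
      N_map := fun v => by
        change (s (κ (proj v))).X.N (proj v) ≤ (s (κ v)).X.N v
        rw [(hlim _ _ (hpk _ v (hκ' v))).1]
        exact ProjStr.N_map _ _
      S_map := fun v => ProjStr.S_map _ _
      S_le := fun v => ProjStr.S_le _ _
      N_le := fun v => by
        change (s (κ (v - proj v))).X.N (v - proj v) ≤ 2 * (s (κ v)).X.S v
        rw [(hlim _ _ (by rw [map_sub, hpk _ v (hκ' v), hκ'])).1]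
        exact ProjStr.N_le _ _ }
  have hX : ∀ k v, trunc (s k).level v = v → X.N v = (s k).X.N v ∧ X.S v = (s k).X.S v := hlim
  refine ⟨X, fun m n Z hmn hZ hXZ ε hε => ?_⟩
  obtain ⟨δ, hδ, hδε, h⟩ := hreal m n Z hZ ε hε
  obtain ⟨k, hk, Z', hZ', h⟩ := h m
  have hmk : m ≤ (s k).level := hk.trans (hlevel k)
  have htm : ∀ v, trunc m (trunc m v) = trunc m v := fun v => by rw [trunc_trunc, min_self]
  -- On the first `m` coordinates the stage agrees with `Z`, hence is `δ`-close to the listed `Z'`.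
  -- The next stage realizes `Z'` exactly, and `Z'` differs from `Z` by at most `δ`.
  obtain ⟨ρ, hρp, hρ, hρm, hρn⟩ := h hmk fun v => by
    have h1 := hX k _ (trunc_eq_self_of_le hmk (htm v))
    have h2 := hXZ _ (htm v)
    rw [← h1.1, ← h1.2, h2.1, h2.2]
    exact ⟨(hZ' _).1.trans (mul_le_mul_of_nonneg_left (ell_N_trunc_le m n v) hδ.le),
      (hZ' _).2.trans (mul_le_mul_of_nonneg_left (ell_S_trunc_le m n v) hδ.le)⟩
  refine ⟨ρ, hρp, fun z hz => ?_, fun v hv => ?_⟩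
  · have h1 := hX (k + 1) _ (hρn z hz)
    rw [h1.1, h1.2, (hρ z).1, (hρ z).2, abs_sub_comm, abs_sub_comm (Z'.S z)]
    exact ⟨(hZ' z).1.trans (mul_le_mul_of_nonneg_right hδε (apply_nonneg _ _)),
      (hZ' z).2.trans (mul_le_mul_of_nonneg_right hδε (apply_nonneg _ _))⟩
  · rw [(hX (k + 1) _ ?_).1]
    · exact (hρm v hv).trans (mul_le_mul_of_nonneg_right hδε (apply_nonneg _ _))
    · rw [map_sub, hρn v (trunc_eq_self_of_le hmn hv),
        trunc_eq_self_of_le (hmk.trans (hext k).level_lt.le) hv]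

end PlaneSeq

/-! ### From coordinates to arbitrary finite-dimensional spaces. -/

namespace ProjStr

section Coordinates

variable {F : Type*} [AddCommGroup F] [Module ℝ F] {pF : F →ₗ[ℝ] F}

/-- The part of a linear map that commutes with the idempotents. -/
def commPart {V : Type*} [AddCommGroup V] [Module ℝ V] (p : V →ₗ[ℝ] V) (pF : F →ₗ[ℝ] F)
    (φ : F →ₗ[ℝ] V) : F →ₗ[ℝ] V :=
  p ∘ₗ φ ∘ₗ pF + (LinearMap.id - p) ∘ₗ φ ∘ₗ (LinearMap.id - pF)

theorem commPart_apply {V : Type*} [AddCommGroup V] [Module ℝ V] (p : V →ₗ[ℝ] V)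
    (pF : F →ₗ[ℝ] F) (φ : F →ₗ[ℝ] V) (f : F) :
    commPart p pF φ f = p (φ (pF f)) + (φ (f - pF f) - p (φ (f - pF f))) := rfl

theorem commPart_comm {V : Type*} [AddCommGroup V] [Module ℝ V] {p : V →ₗ[ℝ] V}
    (hp : ∀ x, p (p x) = p x) (hpF : ∀ x, pF (pF x) = pF x) (φ : F →ₗ[ℝ] V) (f : F) :
    commPart p pF φ (pF f) = p (commPart p pF φ f) := by
  simp [commPart_apply, hp, hpF]

theorem commPart_eq {V : Type*} [AddCommGroup V] [Module ℝ V] {p : V →ₗ[ℝ] V}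
    (hp : ∀ x, p (p x) = p x) {φ : F →ₗ[ℝ] V} (hφ : ∀ f, φ (pF f) = p (φ f)) (f : F) :
    commPart p pF φ f = φ f := by
  simp [commPart_apply, hp, hφ]

/-- Each basis vector contributes one plane: the first axis records a coordinate of `pF f`, the
second one of `f - pF f`. Recombining these two parts gives the retraction `r`, with no basis
adapted to the splitting. -/
theorem exists_coordinates [FiniteDimensional ℝ F] (hpF : ∀ x, pF (pF x) = pF x) :
    ∃ (d : ℕ) (j : F →ₗ[ℝ] PlaneSeq) (r : PlaneSeq →ₗ[ℝ] F),
      (∀ f, j (pF f) = PlaneSeq.proj (j f)) ∧ (∀ v, r (PlaneSeq.proj v) = pF (r v)) ∧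
      (∀ f, r (j f) = f) ∧ ∀ v, r (PlaneSeq.trunc d v) = r v := by
  let d := Module.finrank ℝ F
  let b := Module.finBasis ℝ F
  let ofCoord : PlaneSeq →ₗ[ℝ] F × F := LinearMap.prod
    (∑ i : Fin d, (LinearMap.fst ℝ ℝ ℝ ∘ₗ Finsupp.lapply (i : ℕ)).smulRight (b i))
    (∑ i : Fin d, (LinearMap.snd ℝ ℝ ℝ ∘ₗ Finsupp.lapply (i : ℕ)).smulRight (b i))
  let j : F →ₗ[ℝ] PlaneSeq := PlaneSeq.ofFin d ∘ₗ LinearMap.pi fun i =>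
    LinearMap.prod (b.coord i ∘ₗ pF) (b.coord i ∘ₗ (LinearMap.id - pF))
  have hj : ∀ f (i : Fin d), j f i = (b.repr (pF f) i, b.repr (f - pF f) i) := fun f i =>
    Finsupp.mapDomain_apply Fin.val_injective _ i
  have hj' : ∀ f (i : ℕ), ¬ i < d → j f i = 0 := fun f i hi => by
    refine Finsupp.mapDomain_of_notMem_range _ i ?_
    rintro ⟨k, rfl⟩
    exact hi k.2
  let r : PlaneSeq →ₗ[ℝ] F := LinearMap.coprod pF (LinearMap.id - pF) ∘ₗ ofCoord
  have hr : ∀ v, r v = pF (∑ i : Fin d, (v i).1 • b i) +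
      (∑ i : Fin d, (v i).2 • b i - pF (∑ i : Fin d, (v i).2 • b i)) := fun v => by
    simp [r, ofCoord, smul_sub, Finset.sum_sub_distrib]
  refine ⟨d, j, r, fun f => Finsupp.ext fun i => ?_, fun v => ?_, fun f => ?_, fun v => ?_⟩
  · rw [PlaneSeq.proj_apply]
    by_cases hi : i < d
    · have h1 := hj f ⟨i, hi⟩
      have h2 := hj (pF f) ⟨i, hi⟩
      rw [h1, h2, hpF, sub_self, map_zero]
      rfl
    · rw [hj' _ i hi, hj' _ i hi]
      rfl
  · rw [hr, hr]
    simp [hpF]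
  · rw [hr]
    simp only [hj]
    rw [b.sum_repr, b.sum_repr, map_sub, hpF]
    abel
  · rw [hr, hr]
    simp [PlaneSeq.trunc_apply]

end Coordinates

theorem exists_trunc_eq {F : Type*} [AddCommGroup F] [Module ℝ F]
    [FiniteDimensional ℝ F] (φ : F →ₗ[ℝ] PlaneSeq) :
    ∃ m, ∀ f, PlaneSeq.trunc m (φ f) = φ f := by
  let b := Module.finBasis ℝ F
  choose n hn using fun i => PlaneSeq.exists_trunc_eq_self (φ (b i))
  refine ⟨Finset.univ.sup n, fun f => ?_⟩
  have : PlaneSeq.trunc (Finset.univ.sup n) ∘ₗ φ = φ := b.ext fun i =>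
    PlaneSeq.trunc_eq_self_of_le (Finset.le_sup (Finset.mem_univ i)) (hn i)
  exact LinearMap.congr_fun this f

/-- Exact agreement on the range of `T` gives closeness. -/
theorem Close.of_comp_eq {V F : Type*} [AddCommGroup V] [Module ℝ V] [AddCommGroup F] [Module ℝ F]
    {p : V →ₗ[ℝ] V} {pF : F →ₗ[ℝ] F} {X : ProjStr p} {A : ProjStr pF} {φ : F →ₗ[ℝ] V}
    {T : F →ₗ[ℝ] F} (hφ : ∀ f, φ (pF f) = p (φ f)) (hT : ∀ f, T (pF f) = pF (T f))
    (hN : ∀ f, X.N (φ f) = A.N (T f)) (hS : ∀ f, X.S (φ f) = A.S (T f)) :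
    Close X A (A.comap (LinearMap.id - T) A.idem (fun f => by simp [hT])) φ LinearMap.id where
  left := hφ
  right _ := rfl
  N f := by
    rw [hN, abs_sub_comm]
    exact abs_sub_map_le_sub A.N f (T f)
  S f := by
    rw [hS, abs_sub_comm]
    exact abs_sub_map_le_sub A.S f (T f)

end ProjStr

namespace PlaneSeq

open ProjStr

/-- The range of `φ` lies in the first `m` coordinates and `F` is coded in the next `d`. The amalgam
becomes a pair on `m + d` coordinates that extends `X` on the first `m`, to which genericity
applies. -/
theorem IsGeneric.exists_extension {X : ProjStr proj} (hX : IsGeneric X) {F : Type*}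
    [NormedAddCommGroup F] [NormedSpace ℝ F] [FiniteDimensional ℝ F] {pF : F →ₗ[ℝ] F}
    {A c : ProjStr pF} {φ : F →ₗ[ℝ] PlaneSeq} (h : Close X A c φ LinearMap.id)
    {ε : ℝ} (hε : 0 < ε) :
    ∃ ρ : F →ₗ[ℝ] PlaneSeq, (∀ f, ρ (pF f) = proj (ρ f)) ∧
      (∀ f, |X.N (ρ f) - A.N f| ≤ ε * ‖f‖ ∧ |X.S (ρ f) - A.S f| ≤ ε * ‖f - pF f‖) ∧
      ∀ f, X.N (φ f - ρ f) ≤ c.N f + ε * ‖f‖ := by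
  obtain ⟨d, j, r, hj, hr, hrj, hrd⟩ := exists_coordinates A.idem
  obtain ⟨m, hm⟩ := exists_trunc_eq φ
  let α : PlaneSeq →ₗ[ℝ] PlaneSeq × F := (trunc m).prod (r ∘ₗ unshift m)
  have hα : ∀ v, α (proj v) = (proj.prodMap pF) (α v) := fun v =>
    Prod.ext (trunc_proj m v) (by
      change r (unshift m (proj v)) = pF (r (unshift m v))
      rw [unshift_proj, hr])
  let Z : ProjStr proj := (amalgam h).comap α proj_proj hα
  have hα0 : ∀ v, trunc m v = v → α v = (v, 0) := fun v hv => by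
    refine Prod.ext hv ?_
    change r (unshift m v) = 0
    rw [← hv, unshift_trunc, Nat.sub_self, trunc_zero, map_zero]
  -- Truncation at `d` confines `w f` to the first `m + d` coordinates and is invisible to `r`.
  let w : F →ₗ[ℝ] PlaneSeq := shift m ∘ₗ trunc d ∘ₗ j
  have hαw : ∀ f, α (w f) = (0, f) := fun f => by
    refine Prod.ext (trunc_shift_self m _) ?_
    change r (unshift m (shift m (trunc d (j f)))) = f
    rw [unshift_shift, hrd, hrj]
  have hZ : IsLevel (m + d) Z := fun v => by
    have : α (trunc (m + d) v) = α v := by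
      refine Prod.ext ?_ ?_
      · change trunc m (trunc (m + d) v) = trunc m v
        rw [trunc_trunc, min_eq_left (Nat.le_add_right m d)]
      · change r (unshift m (trunc (m + d) v)) = r (unshift m v)
        rw [unshift_trunc, Nat.add_sub_cancel_left, hrd]
    exact ⟨congrArg (amalgam h).N this, congrArg (amalgam h).S this⟩
  have hZX : ∀ v, trunc m v = v → X.N v = Z.N v ∧ X.S v = Z.S v := fun v hv => by
    change _ = (amalgam h).N (α v) ∧ _ = (amalgam h).S (α v)
    rw [hα0 v hv, amalgam_N_left, amalgam_S_left]
    exact ⟨rfl, rfl⟩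
  obtain ⟨C₁, hC₁, h₁⟩ := ((ell (m + d)).N.comp w).exists_le_mul_norm
  obtain ⟨C₂, hC₂, h₂⟩ := ((ell m).N.comp φ).exists_le_mul_norm
  obtain ⟨C₃, hC₃, h₃⟩ := ((ell (m + d)).N.comp φ).exists_le_mul_norm
  simp only [Seminorm.comp_apply] at h₁ h₂ h₃
  let η := ε / (C₁ + C₂ + C₃)
  have hC : 0 < C₁ + C₂ + C₃ := by positivity
  have hη : 0 < η := div_pos hε hC
  have hηε : η * (C₁ + C₂ + C₃) = ε := div_mul_cancel₀ _ hC.ne'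
  have hη₁ : η * C₁ ≤ ε := by
    rw [← hηε]
    exact mul_le_mul_of_nonneg_left (by linarith) hη.le
  obtain ⟨ρ, hρp, hρ, hρm⟩ := hX m (m + d) Z (Nat.le_add_right m d) hZ hZX η hη
  have hw : ∀ f, w (pF f) = proj (w f) := fun f => by
    change shift m (trunc d (j (pF f))) = proj (shift m (trunc d (j f)))
    rw [hj, trunc_proj, shift_proj]
  have hwn : ∀ f, trunc (m + d) (w f) = w f := fun f => by
    change trunc (m + d) (shift m (trunc d (j f))) = shift m (trunc d (j f))
    rw [add_comm, trunc_add_shift, trunc_trunc, min_self]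
  have hZw : ∀ f, Z.N (w f) = A.N f ∧ Z.S (w f) = A.S f := fun f => by
    change (amalgam h).N (α (w f)) = _ ∧ (amalgam h).S (α (w f)) = _
    rw [hαw, amalgam_N_right, amalgam_S_right]
    exact ⟨rfl, rfl⟩
  refine ⟨ρ ∘ₗ w, fun f => ?_, fun f => ?_, fun f => ?_⟩
  · change ρ (w (pF f)) = proj (ρ (w f))
    rw [hw, hρp]
  · have h4 := hρ (w f) (hwn f)
    rw [(hZw f).1, (hZw f).2] at h4
    refine ⟨h4.1.trans ?_, h4.2.trans ?_⟩
    · calc η * (ell (m + d)).N (w f) ≤ η * (C₁ * ‖f‖) := by gcongr; exact h₁ f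
        _ = (η * C₁) * ‖f‖ := by ring
        _ ≤ ε * ‖f‖ := by gcongr
    · rw [ell_S_eq, ← hw, ← map_sub]
      calc η * (ell (m + d)).N (w (f - pF f)) ≤ η * (C₁ * ‖f - pF f‖) := by gcongr; exact h₁ _
        _ = (η * C₁) * ‖f - pF f‖ := by ring
        _ ≤ ε * ‖f - pF f‖ := by gcongr
  · have h4 := hρm (φ f) (hm f)
    have h5 := (abs_le.1 (hρ (φ f - w f) (by
      rw [map_sub, hwn, trunc_eq_self_of_le (Nat.le_add_right m d) (hm f)])).1).2
    have h6 : Z.N (φ f - w f) ≤ c.N f := by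
      change (amalgam h).N (α (φ f - w f)) ≤ _
      rw [map_sub, hα0 _ (hm f), hαw, Prod.mk_sub_mk, sub_zero, zero_sub]
      exact amalgam_N_cross h f
    -- The difference splits as `(φ f - ρ (φ f)) + ρ (φ f - w f)`: the first term is small since `ρ`
    -- almost fixes the first `m` coordinates, the second is almost the cross distance in the
    -- amalgam.
    have h7 := map_sub_le_add (ell (m + d)).N (φ f) (w f)
    have h8 := map_add_le_add X.N (φ f - ρ (φ f)) (ρ (φ f - w f))
    rw [map_sub ρ, sub_add_sub_cancel, ← map_sub ρ] at h8
    have h9 : η * (ell m).N (φ f) ≤ η * (C₂ * ‖f‖) := by gcongr; exact h₂ f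
    have h10 : η * (ell (m + d)).N (φ f - w f) ≤ η * (C₃ * ‖f‖ + C₁ * ‖f‖) := by
      gcongr
      exact h7.trans (add_le_add (h₃ f) (h₁ f))
    have h11 : ε * ‖f‖ = η * (C₂ * ‖f‖) + η * (C₃ * ‖f‖ + C₁ * ‖f‖) := by rw [← hηε]; ring
    change X.N (φ f - ρ (w f)) ≤ _
    linarith

end PlaneSeq

/-! ### The generic `S` is the distance to the range. -/

/-- The structure on the plane used to attain the distance to the range of the projection. -/
noncomputable def planeStr (r s : NNReal) (hrs : r ≤ 2 * s) :
    ProjStr (LinearMap.inr ℝ ℝ ℝ ∘ₗ LinearMap.snd ℝ ℝ ℝ) where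
  N := (r • (normSeminorm ℝ ℝ).comp (LinearMap.fst ℝ ℝ ℝ + (1 / 2 : ℝ) • LinearMap.snd ℝ ℝ ℝ)) ⊔
    (s • (normSeminorm ℝ ℝ).comp (LinearMap.fst ℝ ℝ ℝ)) ⊔
    ((r / 2) • (normSeminorm ℝ ℝ).comp (LinearMap.snd ℝ ℝ ℝ))
  S := s • (normSeminorm ℝ ℝ).comp (LinearMap.fst ℝ ℝ ℝ)
  idem _ := rfl
  N_map x := by
    change max (max (r * |0 + (1 / 2 : ℝ) * x.2|) (s * |(0 : ℝ)|)) (((r / 2 : NNReal) : ℝ) * |x.2|)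
      ≤ max (max (r * |x.1 + (1 / 2 : ℝ) * x.2|) (s * |x.1|)) (((r / 2 : NNReal) : ℝ) * |x.2|)
    -- The third term of the maximum equals the first term at the projected point; it is there to
    -- make the idempotent contractive.
    have h : (((r / 2 : NNReal) : ℝ) * |x.2|) = r * |0 + (1 / 2 : ℝ) * x.2| := by
      rw [zero_add, abs_mul, abs_of_pos (by norm_num : (0 : ℝ) < 1 / 2)]
      push_cast
      ring
    refine max_le (max_le ?_ ?_) (le_max_right _ _)
    · rw [← h]; exact le_max_right _ _
    · rw [abs_zero, mul_zero]
      exact (mul_nonneg (r / 2).2 (abs_nonneg _)).trans (le_max_right _ _)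
  S_map x := by
    change (s : ℝ) * |(0 : ℝ)| = 0
    simp
  S_le x := (le_max_right _ _).trans (le_max_left _ _)
  N_le x := by
    change max (max (r * |x.1 - 0 + (1 / 2 : ℝ) * (x.2 - x.2)|) (s * |x.1 - 0|))
      (((r / 2 : NNReal) : ℝ) * |x.2 - x.2|) ≤ 2 * (s * |x.1|)
    have h1 : (r : ℝ) * |x.1| ≤ (2 * s) * |x.1| :=
      mul_le_mul_of_nonneg_right (by exact_mod_cast hrs) (abs_nonneg _)
    have h2 : 0 ≤ (s : ℝ) * |x.1| := mul_nonneg s.2 (abs_nonneg _)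
    simp only [sub_self, mul_zero, add_zero, sub_zero, abs_zero]
    refine max_le (max_le ?_ ?_) ?_ <;> linarith

theorem planeStr_N (r s : NNReal) (hrs : r ≤ 2 * s) (x : ℝ × ℝ) :
    (planeStr r s hrs).N x =
      max (max (r * |x.1 + (1 / 2 : ℝ) * x.2|) (s * |x.1|)) (((r / 2 : NNReal) : ℝ) * |x.2|) := rfl

theorem planeStr_S (r s : NNReal) (hrs : r ≤ 2 * s) (x : ℝ × ℝ) :
    (planeStr r s hrs).S x = s * |x.1| := rfl

namespace PlaneSeq

open ProjStr

/-- In the plane, `(1, 0)` stands for `v - proj v` and the second axis is the range. The point `(0,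
1)` is at `N`-distance at most `max s (r / 2) = s` from `(1, 0)`, since `r ≤ 2 * s`. Its generic
image almost attains the value `X.S v`. -/
theorem IsGeneric.exists_N_sub_le {X : ProjStr proj} (hX : IsGeneric X) (v : PlaneSeq) {ε : ℝ}
    (hε : 0 < ε) : ∃ w, X.N (v - proj w) ≤ X.S v + ε := by
  let v₁ := v - proj v
  have hv₁ : proj v₁ = 0 := by
    simp only [v₁, map_sub, proj_proj, sub_self]
  let r : NNReal := ⟨X.N v₁, apply_nonneg _ _⟩
  let s : NNReal := ⟨X.S v, apply_nonneg _ _⟩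
  have hsr : s ≤ r := X.S_le_N_sub v
  have hrs : r ≤ 2 * s := X.N_le v
  let A := planeStr r s hrs
  let T : ℝ × ℝ →ₗ[ℝ] ℝ × ℝ := LinearMap.inl ℝ ℝ ℝ ∘ₗ LinearMap.fst ℝ ℝ ℝ
  let φ : ℝ × ℝ →ₗ[ℝ] PlaneSeq := (LinearMap.fst ℝ ℝ ℝ).smulRight v₁
  have hclose := Close.of_comp_eq (X := X) (A := A) (φ := φ) (T := T)
    (fun f => by simp [φ, hv₁]) (fun f => by simp [T])
    (fun f => by
      have h1 : (s : ℝ) * |f.1| ≤ r * |f.1| :=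
        mul_le_mul_of_nonneg_right (by exact_mod_cast hsr) (abs_nonneg _)
      have h2 : 0 ≤ (r : ℝ) * |f.1| := mul_nonneg r.2 (abs_nonneg _)
      have h3 : X.N (φ f) = |f.1| * r := map_smul_eq_mul _ _ _
      rw [h3, planeStr_N]
      simp only [T, LinearMap.comp_apply, LinearMap.fst_apply, LinearMap.inl_apply, mul_zero,
        add_zero, abs_zero]
      rw [max_eq_left h1, max_eq_left h2, mul_comm])
    (fun f => by
      have h3 : X.S (φ f) = |f.1| * X.S v₁ := map_smul_eq_mul _ _ _
      rw [h3, planeStr_S, X.S_sub_map, mul_comm]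
      rfl)
  have hε2 : 0 < ε / 2 := half_pos hε
  obtain ⟨ρ, hρp, hρ, hφρ⟩ := hX.exists_extension hclose hε2
  have h1 := hφρ (1, 0)
  have h2 := (abs_le.1 (hρ (1, -1)).1).2
  have e1 : φ (1, 0) = v₁ := one_smul ℝ v₁
  have e2 : ‖((1, 0) : ℝ × ℝ)‖ = 1 := by simp [Prod.norm_def]
  have e3 : ‖((1, -1) : ℝ × ℝ)‖ = 1 := by simp [Prod.norm_def]
  have e4 : (A.comap (LinearMap.id - T) A.idem (fun f => by simp [T])).N (1, 0) = 0 := by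
    rw [comap_N]
    simp [T]
  have e5 : A.N (1, -1) ≤ X.S v := by
    have hrs' : (r : ℝ) ≤ 2 * s := by exact_mod_cast hrs
    rw [planeStr_N]
    refine max_le (max_le ?_ ?_) ?_
    · have : |(1 : ℝ) + 1 / 2 * (-1)| = 1 / 2 := by norm_num [abs_of_pos]
      change (r : ℝ) * |(1 : ℝ) + 1 / 2 * (-1)| ≤ s
      rw [this]
      linarith
    · change (s : ℝ) * |(1 : ℝ)| ≤ s
      rw [abs_one, mul_one]
    · push_cast
      rw [abs_neg, abs_one, mul_one]
      change (r : ℝ) / 2 ≤ s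
      linarith
  have e6 : ρ (0, 1) = proj (ρ (0, 1)) := by
    rw [← hρp]
    simp
  refine ⟨v + ρ (0, 1), ?_⟩
  have e7 : v - proj (v + ρ (0, 1)) = (v₁ - ρ (1, 0)) + ρ (1, -1) := by
    have : ((1, -1) : ℝ × ℝ) = (1, 0) - (0, 1) := by simp
    rw [this, map_sub, map_add, ← e6]
    simp only [v₁]
    abel
  rw [e7]
  refine (map_add_le_add X.N _ _).trans ?_
  rw [e1, e2, e4] at h1
  rw [e3] at h2
  linarith

end PlaneSeq

/-! ### The completion and its extension property. -/

/-- A vector space, topologized by a seminorm. -/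
def WithSeminorm {V : Type*} [AddCommGroup V] [Module ℝ V] (_ : Seminorm ℝ V) : Type _ := V

namespace WithSeminorm

variable {V : Type*} [AddCommGroup V] [Module ℝ V] (q : Seminorm ℝ V)

noncomputable instance : SeminormedAddCommGroup (WithSeminorm q) :=
  q.toAddGroupSeminorm.toSeminormedAddCommGroup

noncomputable instance : NormedSpace ℝ (WithSeminorm q) where
  __ := (inferInstance : Module ℝ V)
  norm_smul_le a x := (map_smul_eq_mul q a x).le

/-- The identity map into the seminormed space. -/
noncomputable def of : V ≃ₗ[ℝ] WithSeminorm q := LinearEquiv.refl ℝ V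

end WithSeminorm

/-- Finite dimensional extensions of structures extend, approximately, over maps into `G`: the
subspace is given as the range of an idempotent `T`. -/
def HasExtensions {G : Type v} [NormedAddCommGroup G] [NormedSpace ℝ G] {P : G →L[ℝ] G}
    {H : Submodule ℝ G} (h : IsContractiveProjection P H) : Prop :=
  ∀ (F : Type w) [NormedAddCommGroup F] [NormedSpace ℝ F] [FiniteDimensional ℝ F]
    (pF : F →ₗ[ℝ] F) (A : ProjStr pF) (T : F →ₗ[ℝ] F) (φ : F →ₗ[ℝ] G),
    (∀ f, T (T f) = T f) → (∀ f, T (pF f) = pF (T f)) → (∀ f, φ (T f) = φ f) →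
    (∀ f, φ (pF f) = P (φ f)) → (∀ f, ‖φ f‖ = A.N (T f)) →
    (∀ f, (ProjStr.ofProjection h).S (φ f) = A.S (T f)) → ∀ ε > (0 : ℝ),
    ∃ ψ : F →ₗ[ℝ] G, (∀ f, ψ (T f) = φ f) ∧ (∀ f, ψ (pF f) = P (ψ f)) ∧
      ∀ f, |‖ψ f‖ - A.N f| ≤ ε * ‖f‖ ∧
        |(ProjStr.ofProjection h).S (ψ f) - A.S f| ≤ ε * ‖f - pF f‖

namespace ProjStr

variable {V W : Type*} [AddCommGroup V] [Module ℝ V] [AddCommGroup W] [Module ℝ W]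
  {p : V →ₗ[ℝ] V} {q : W →ₗ[ℝ] W}

/-- Maps that commute with the idempotents and are close for `N` are close for `S`. -/
theorem abs_S_sub_le (X : ProjStr q) {φ ψ : V →ₗ[ℝ] W} (hφ : ∀ x, φ (p x) = q (φ x))
    (hψ : ∀ x, ψ (p x) = q (ψ x)) (x : V) :
    |X.S (φ x) - X.S (ψ x)| ≤ X.N (φ (x - p x) - ψ (x - p x)) := by
  refine (abs_sub_map_le_sub X.S _ _).trans ((X.S_le_N_sub _).trans (le_of_eq ?_))
  simp only [map_sub, hφ, hψ]
  congr 1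
  abel

/-- The structure for which `N` is equivalent to the norm of a finite dimensional space. -/
noncomputable def ofNorm {F : Type*} [NormedAddCommGroup F] [NormedSpace ℝ F] {pF : F →ₗ[ℝ] F}
    (hp : ∀ x, pF (pF x) = pF x) : ProjStr pF where
  N := (normSeminorm ℝ F).comp pF + (normSeminorm ℝ F).comp (LinearMap.id - pF)
  S := (normSeminorm ℝ F).comp (LinearMap.id - pF)
  idem := hp
  N_map x := by simp [hp]
  S_map x := by simp [hp]
  S_le x := le_add_of_nonneg_left (norm_nonneg _)
  N_le x := by
    simp [hp]
    linarith [norm_nonneg (x - pF x)]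

theorem ofNorm_N {F : Type*} [NormedAddCommGroup F] [NormedSpace ℝ F] {pF : F →ₗ[ℝ] F}
    (hp : ∀ x, pF (pF x) = pF x) (x : F) : (ofNorm hp).N x = ‖pF x‖ + ‖x - pF x‖ := rfl

theorem norm_le_ofNorm_N {F : Type*} [NormedAddCommGroup F] [NormedSpace ℝ F] {pF : F →ₗ[ℝ] F}
    (hp : ∀ x, pF (pF x) = pF x) (x : F) : ‖x‖ ≤ (ofNorm hp).N x := by
  simpa [ofNorm_N] using norm_add_le (pF x) (x - pF x)

end ProjStr

theorem LinearMap.exists_approx_of_denseRange {F V G : Type*} [NormedAddCommGroup F]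
    [NormedSpace ℝ F] [FiniteDimensional ℝ F] [AddCommGroup V] [Module ℝ V] [NormedAddCommGroup G]
    [NormedSpace ℝ G] {i : V →ₗ[ℝ] G} (hi : DenseRange i) (φ : F →ₗ[ℝ] G) {ε : ℝ} (hε : 0 < ε) :
    ∃ ψ : F →ₗ[ℝ] V, ∀ f, ‖φ f - i (ψ f)‖ ≤ ε * ‖f‖ := by
  let b := Module.finBasis ℝ F
  let q : Seminorm ℝ F := ∑ k, (normSeminorm ℝ ℝ).comp (b.coord k)
  have hq : ∀ f, q f = ∑ k, |b.repr f k| := fun f => by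
    simp [q]
  obtain ⟨C, hC, h⟩ := q.exists_le_mul_norm
  have hη : 0 < ε / C := div_pos hε hC
  choose w hw using fun k => hi.exists_dist_lt (φ (b k)) hη
  refine ⟨b.constr ℝ w, fun f => ?_⟩
  have : φ f - i (b.constr ℝ w f) = ∑ k, b.repr f k • (φ (b k) - i (w k)) := by
    rw [b.constr_apply_fintype ℝ]
    have h1 : φ f = ∑ k, b.repr f k • φ (b k) := by
      conv_lhs => rw [← b.sum_repr f]
      simp only [map_sum, map_smul]
    simp [smul_sub, Finset.sum_sub_distrib, h1]
  rw [this]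
  calc ‖∑ k, b.repr f k • (φ (b k) - i (w k))‖ ≤ ∑ k, |b.repr f k| * (ε / C) := by
        refine norm_sum_le_of_le _ fun k _ => ?_
        rw [norm_smul, Real.norm_eq_abs, ← dist_eq_norm]
        exact mul_le_mul_of_nonneg_left (hw k).le (abs_nonneg _)
    _ = q f * (ε / C) := by rw [hq, Finset.sum_mul]
    _ ≤ (C * ‖f‖) * (ε / C) := by gcongr; exact h f
    _ = ε * ‖f‖ := by field_simp

namespace PlaneSeq

open ProjStr UniformSpace

variable (X : ProjStr proj)

/-- The completion of the space of finite sequences for a structure. -/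
abbrev Compl : Type := Completion (WithSeminorm X.N)

/-- The inclusion of the finite sequences into the completion. -/
noncomputable def incl : PlaneSeq →ₗ[ℝ] Compl X :=
  (Completion.toComplL (𝕜 := ℝ) (E := WithSeminorm X.N)).toLinearMap ∘ₗ
    (WithSeminorm.of X.N).toLinearMap

@[simp] theorem norm_incl (v : PlaneSeq) : ‖incl X v‖ = X.N v := Completion.norm_coe _

theorem denseRange_incl : DenseRange (incl X) :=
  (Completion.denseRange_coe (α := WithSeminorm X.N))

theorem separableSpace_compl : TopologicalSpace.SeparableSpace (Compl X) := by
  have h : TopologicalSpace.IsSeparable (Set.range (incl X)) := by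
    have h1 : Set.range (incl X) ⊆ ⋃ n, Set.range (incl X ∘ₗ ofFin n) := by
      rintro _ ⟨v, rfl⟩
      obtain ⟨n, hn⟩ := exists_trunc_eq_self v
      refine Set.mem_iUnion.2 ⟨n, fun i => v i, ?_⟩
      rw [LinearMap.comp_apply, ofFin_apply, hn]
    refine TopologicalSpace.IsSeparable.mono (TopologicalSpace.IsSeparable.iUnion fun n => ?_) h1
    exact TopologicalSpace.isSeparable_range (LinearMap.continuous_of_finiteDimensional _)
  rw [← TopologicalSpace.isSeparable_univ_iff, ← (denseRange_incl X).closure_range]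
  exact h.closure

/-- The extension of the projection to the completion. -/
noncomputable def complProj : Compl X →L[ℝ] Compl X :=
  LinearMap.extendOfNorm (incl X ∘ₗ proj) (incl X)

theorem complProj_incl (v : PlaneSeq) : complProj X (incl X v) = incl X (proj v) :=
  LinearMap.extendOfNorm_eq (denseRange_incl X)
    ⟨1, fun v => by simpa using X.N_map v⟩ v

theorem norm_complProj_apply_le (x : Compl X) : ‖complProj X x‖ ≤ ‖x‖ := by
  have := LinearMap.norm_extendOfNorm_apply_le (f := incl X ∘ₗ proj) (e := incl X)
    (denseRange_incl X) 1 (fun v => by simpa using X.N_map v) x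
  rwa [one_mul] at this

theorem complProj_complProj (x : Compl X) : complProj X (complProj X x) = complProj X x := by
  refine (denseRange_incl X).induction_on x (isClosed_eq (by fun_prop) (by fun_prop)) fun v => ?_
  rw [complProj_incl, complProj_incl, proj_proj]

theorem isContractiveProjection_complProj :
    IsContractiveProjection (complProj X) (complProj X).range where
  norm_le := ContinuousLinearMap.opNorm_le_bound _ zero_le_one fun x => by
    simpa using norm_complProj_apply_le X x
  mem x := ⟨x, rfl⟩
  fix := by
    rintro _ ⟨x, rfl⟩
    exact complProj_complProj X x

variable {X}

/-- The upper bound is genericity. The lower bound needs only that `S` vanishes on the range and is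
below `N`, and passes to limits by density. -/
theorem IsGeneric.S_incl (hX : IsGeneric X) (v : PlaneSeq) :
    (ofProjection (isContractiveProjection_complProj X)).S (incl X v) = X.S v := by
  change Metric.infDist (incl X v) _ = _
  apply le_antisymm
  · refine le_of_forall_pos_le_add fun ε hε => ?_
    obtain ⟨w, hw⟩ := hX.exists_N_sub_le v hε
    refine le_trans (Metric.infDist_le_dist_of_mem (y := incl X (proj w)) ?_) (le_trans ?_ hw)
    · exact ⟨incl X w, complProj_incl X w⟩
    · rw [dist_eq_norm, ← map_sub, norm_incl]
  · refine (Metric.le_infDist ⟨0, Submodule.zero_mem _⟩).2 ?_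
    rintro _ ⟨x, rfl⟩
    rw [dist_eq_norm]
    change X.S v ≤ ‖incl X v - complProj X x‖
    refine (denseRange_incl X).induction_on x (isClosed_le (by fun_prop) (by fun_prop)) fun w => ?_
    rw [complProj_incl, ← map_sub, norm_incl]
    refine le_trans (le_of_eq ?_) (X.S_le _)
    have h1 := map_sub_le_add X.S v (proj w)
    have h2 := map_add_le_add X.S (v - proj w) (proj w)
    rw [sub_add_cancel] at h2
    rw [X.S_map] at h1 h2
    linarith

/-- A nearby map into the sequences replaces `φ`, and the approximation error joins `c` as a small
multiple of `ofNorm`. The norm of `F` itself could not serve, since `pF` need not be contractive for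
it. -/
theorem IsGeneric.exists_compl_extension (hX : IsGeneric X) {F : Type w} [NormedAddCommGroup F]
    [NormedSpace ℝ F] [FiniteDimensional ℝ F] {pF : F →ₗ[ℝ] F} {A c : ProjStr pF}
    {φ : F →ₗ[ℝ] Compl X}
    (h : Close (ofProjection (isContractiveProjection_complProj X)) A c φ LinearMap.id)
    {ε : ℝ} (hε : 0 < ε) :
    ∃ ρ : F →ₗ[ℝ] Compl X, (∀ f, ρ (pF f) = complProj X (ρ f)) ∧
      (∀ f, |‖ρ f‖ - A.N f| ≤ ε * ‖f‖ ∧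
        |(ofProjection (isContractiveProjection_complProj X)).S (ρ f) - A.S f| ≤
          ε * ‖f - pF f‖) ∧
      ∀ f, ‖φ f - ρ f‖ ≤ c.N f + ε * ‖f‖ := by
  set B := ofProjection (isContractiveProjection_complProj X) with hB
  obtain ⟨C, hC, hpF⟩ := ((normSeminorm ℝ F).comp pF).exists_le_mul_norm
  simp only [Seminorm.comp_apply, coe_normSeminorm] at hpF
  have hqF : ∀ f, ‖f - pF f‖ ≤ (1 + C) * ‖f‖ := fun f => by
    have := norm_sub_le f (pF f)
    linarith [hpF f]
  have hK : ∀ f, (ofNorm A.idem).N f ≤ (1 + 2 * C) * ‖f‖ := fun f => by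
    rw [ofNorm_N]
    linarith [hpF f, hqF f]
  obtain ⟨η, hη, hηε⟩ : ∃ η : ℝ, 0 < η ∧ η * (1 + (1 + 2 * C) + 1) = ε :=
    ⟨ε / (1 + (1 + 2 * C) + 1), by positivity, by field_simp⟩
  obtain ⟨δ, hδ, hδη⟩ : ∃ δ : ℝ, 0 < δ ∧ δ * (C + 2 * (1 + C)) = η :=
    ⟨η / (C + 2 * (1 + C)), by positivity, by field_simp⟩
  obtain ⟨φ₀, hφ₀⟩ := LinearMap.exists_approx_of_denseRange (denseRange_incl X) φ hδ
  -- The approximation need not commute with the projections; passing to its commuting part restores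
  -- this and fixes `φ`, at the cost of the factor `C + 2 * (1 + C)`.
  let φ' := commPart proj pF φ₀
  have hφ'p : ∀ f, φ' (pF f) = proj (φ' f) := commPart_comm proj_proj A.idem φ₀
  have hφ' : ∀ f, ‖φ f - incl X (φ' f)‖ ≤ η * ‖f‖ := fun f => by
    let D := φ - incl X ∘ₗ φ₀
    have hD : ∀ f, ‖D f‖ ≤ δ * ‖f‖ := hφ₀
    have h1 : φ f - incl X (φ' f) =
        complProj X (D (pF f)) + (D (f - pF f) - complProj X (D (f - pF f))) := by
      have h2 := commPart_eq (p := (complProj X : Compl X →ₗ[ℝ] Compl X))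
        (complProj_complProj X) h.left f
      rw [← h2, commPart_apply, commPart_apply]
      simp only [D, LinearMap.sub_apply, LinearMap.comp_apply, map_sub, map_add,
        complProj_incl, ContinuousLinearMap.coe_coe]
      abel
    rw [h1]
    have h3 := norm_complProj_apply_le X (D (pF f))
    have h4 := norm_complProj_apply_le X (D (f - pF f))
    have h5 := norm_add_le (complProj X (D (pF f)))
      (D (f - pF f) - complProj X (D (f - pF f)))
    have h6 := norm_sub_le (D (f - pF f)) (complProj X (D (f - pF f)))
    have h7 : δ * ‖pF f‖ ≤ δ * (C * ‖f‖) := by gcongr; exact hpF f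
    have h8 : δ * ‖f - pF f‖ ≤ δ * ((1 + C) * ‖f‖) := by gcongr; exact hqF f
    have h9 : η * ‖f‖ = δ * (C * ‖f‖) + 2 * (δ * ((1 + C) * ‖f‖)) := by rw [← hδη]; ring
    linarith [hD (pF f), hD (f - pF f)]
  let κ : NNReal := ⟨η, hη.le⟩
  have hclose : Close X A (c.add ((ofNorm A.idem).smul κ)) φ' LinearMap.id :=
    { left := hφ'p
      right := fun _ => rfl
      N := fun f => by
        have h1 := h.N f
        have h2 := (abs_norm_sub_norm_le (incl X (φ' f)) (φ f)).trans
          ((norm_sub_rev _ _).trans_le (hφ' f))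
        rw [norm_incl] at h2
        have h3 : η * ‖f‖ ≤ η * (ofNorm A.idem).N f := by gcongr; exact norm_le_ofNorm_N _ f
        have h4 := abs_sub_le (X.N (φ' f)) ‖φ f‖ (A.N f)
        change _ ≤ c.N f + η * (ofNorm A.idem).N f
        change |‖φ f‖ - A.N f| ≤ _ at h1
        change |X.N (φ' f) - A.N f| ≤ _
        linarith
      S := fun f => by
        have h1 := h.S f
        have h2 := B.abs_S_sub_le (φ := incl X ∘ₗ φ') (p := pF)
          (fun f => by
            change incl X (φ' (pF f)) = complProj X (incl X (φ' f))
            rw [hφ'p, complProj_incl]) h.left f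
        have h3 : B.S ((incl X ∘ₗ φ') f) = X.S (φ' f) := hX.S_incl _
        have h4 : B.N ((incl X ∘ₗ φ') (f - pF f) - φ (f - pF f)) ≤ η * ‖f - pF f‖ := by
          refine le_trans (le_of_eq ?_) (hφ' (f - pF f))
          exact norm_sub_rev (incl X (φ' (f - pF f))) _
        rw [h3] at h2
        have h5 := abs_sub_le (X.S (φ' f)) (B.S (φ f)) (A.S f)
        change _ ≤ c.S f + η * ‖f - pF f‖
        change |X.S (φ' f) - A.S f| ≤ _
        change |B.S (φ f) - A.S f| ≤ _ at h1
        linarith }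
  obtain ⟨ρ, hρp, hρ, hρφ⟩ := hX.exists_extension hclose hη
  have hηε' : η ≤ ε := by
    rw [← hηε]
    exact le_mul_of_one_le_right hη.le (by linarith)
  refine ⟨incl X ∘ₗ ρ, fun f => ?_, fun f => ⟨?_, ?_⟩, fun f => ?_⟩
  · simp only [LinearMap.comp_apply]
    rw [hρp, complProj_incl]
  · rw [LinearMap.comp_apply, norm_incl]
    exact (hρ f).1.trans (mul_le_mul_of_nonneg_right hηε' (norm_nonneg _))
  · rw [LinearMap.comp_apply, hX.S_incl]
    exact (hρ f).2.trans (mul_le_mul_of_nonneg_right hηε' (norm_nonneg _))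
  · have h1 := norm_sub_le_norm_sub_add_norm_sub (φ f) (incl X (φ' f)) (incl X (ρ f))
    rw [← map_sub, norm_incl] at h1
    have h2 := hρφ f
    change _ ≤ c.N f + η * (ofNorm A.idem).N f + η * ‖f‖ at h2
    have h3 : η * (ofNorm A.idem).N f ≤ η * ((1 + 2 * C) * ‖f‖) := by gcongr; exact hK f
    have h4 : ε * ‖f‖ = η * ‖f‖ + η * ((1 + 2 * C) * ‖f‖) + η * ‖f‖ := by rw [← hηε]; ring
    change ‖φ f - incl X (ρ f)‖ ≤ _
    linarith [hφ' f]

/-- The error `A (f - T f)` is zero on the range of `T`, so there the approximate extension `ρ` is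
as near to `φ` as desired and a small correction makes it exact. -/
theorem IsGeneric.hasExtensions (hX : IsGeneric X) :
    HasExtensions.{0, w} (isContractiveProjection_complProj X) := by
  intro F _ _ _ pF A T φ hTT hTp hφT hφp hN hS ε hε
  set B := ofProjection (isContractiveProjection_complProj X)
  obtain ⟨C, hC, hT⟩ := ((normSeminorm ℝ F).comp T).exists_le_mul_norm
  simp only [Seminorm.comp_apply, coe_normSeminorm] at hT
  obtain ⟨η, hη, hηε⟩ : ∃ η : ℝ, 0 < η ∧ η * (1 + C) = ε :=
    ⟨ε / (1 + C), by positivity, by field_simp⟩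
  obtain ⟨ρ, hρp, hρ, hρφ⟩ := hX.exists_compl_extension
    (Close.of_comp_eq (X := B) (A := A) hφp hTp hN hS) hη
  -- On the range of `T` this equals `φ`; it commutes with the projections because `T` does.
  let ψ := ρ + (φ - ρ) ∘ₗ T
  have hψp : ∀ f, ψ (pF f) = complProj X (ψ f) := fun f => by
    simp [ψ, hρp, hTp, hφp]
  have hψρ : ∀ f, ‖ψ f - ρ f‖ ≤ (η * C) * ‖f‖ := fun f => by
    have h1 : ψ f - ρ f = φ (T f) - ρ (T f) := by simp [ψ]
    have h2 := hρφ (T f)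
    have h3 : (A.comap (LinearMap.id - T) A.idem (fun f => by simp [hTp])).N (T f) = 0 := by
      rw [comap_N, LinearMap.sub_apply, LinearMap.id_apply, hTT, sub_self, map_zero]
    rw [h3, zero_add] at h2
    rw [h1]
    refine h2.trans ?_
    rw [mul_assoc]
    exact mul_le_mul_of_nonneg_left (hT f) hη.le
  refine ⟨ψ, fun f => by simp [ψ, hTT, hφT], hψp, fun f => ⟨?_, ?_⟩⟩
  · have h1 := (abs_norm_sub_norm_le (ψ f) (ρ f)).trans (hψρ f)
    have h2 := abs_sub_le ‖ψ f‖ ‖ρ f‖ (A.N f)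
    have h3 : ε * ‖f‖ = η * ‖f‖ + (η * C) * ‖f‖ := by rw [← hηε]; ring
    linarith [(hρ f).1]
  · have h1 := (B.abs_S_sub_le hψp hρp f).trans (hψρ _)
    have h2 := abs_sub_le (B.S (ψ f)) (B.S (ρ f)) (A.S f)
    have h3 : ε * ‖f - pF f‖ = η * ‖f - pF f‖ + (η * C) * ‖f - pF f‖ := by rw [← hηε]; ring
    linarith [(hρ f).2]

end PlaneSeq

theorem IsEpsIsometry.of_abs_le {X Y : Type*} [NormedAddCommGroup X] [NormedSpace ℝ X]
    [NormedAddCommGroup Y] [NormedSpace ℝ Y] {ε η : ℝ} {φ : X →ₗ[ℝ] Y} (hη : η ≤ ε)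
    (h : ∀ x, |‖φ x‖ - ‖x‖| ≤ η * ‖x‖) : IsEpsIsometry ε φ := fun x => by
  have h1 := abs_le.1 ((h x).trans (mul_le_mul_of_nonneg_right hη (norm_nonneg x)))
  constructor <;> linarith

theorem LinearMap.injective_of_abs_norm_sub_le {X Y : Type*} [NormedAddCommGroup X]
    [NormedSpace ℝ X] [NormedAddCommGroup Y] [NormedSpace ℝ Y] {η : ℝ} {φ : X →ₗ[ℝ] Y} (hη : η < 1)
    (h : ∀ x, |‖φ x‖ - ‖x‖| ≤ η * ‖x‖) : Function.Injective φ := by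
  refine (injective_iff_map_eq_zero φ).2 fun x hx => ?_
  have h1 := (abs_le.1 (h x)).1
  rw [hx, norm_zero] at h1
  have h2 : (1 - η) * ‖x‖ ≤ 0 := by linarith
  exact norm_le_zero_iff.1 (nonpos_of_mul_nonpos_right h2 (by linarith))

/-! ### Transport along isometric isomorphisms. -/

section Transport

variable {G : Type v} [NormedAddCommGroup G] [NormedSpace ℝ G] {P : G →L[ℝ] G} {H : Submodule ℝ G}
  {G' : Type*} [NormedAddCommGroup G'] [NormedSpace ℝ G']

/-- The conjugate of a projection under a linear isometric isomorphism. -/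
noncomputable def conjProj (P : G →L[ℝ] G) (e : G ≃ₗᵢ[ℝ] G') : G' →L[ℝ] G' :=
  (e : G →L[ℝ] G') ∘L P ∘L (e.symm : G' →L[ℝ] G)

theorem conjProj_apply (P : G →L[ℝ] G) (e : G ≃ₗᵢ[ℝ] G') (x : G') :
    conjProj P e x = e (P (e.symm x)) := rfl

theorem IsContractiveProjection.conj (h : IsContractiveProjection P H) (e : G ≃ₗᵢ[ℝ] G') :
    IsContractiveProjection (conjProj P e) (H.map e.toLinearEquiv.toLinearMap) where
  norm_le := ContinuousLinearMap.opNorm_le_bound _ zero_le_one fun x => by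
    rw [conjProj_apply, e.norm_map]
    simpa using P.le_of_opNorm_le h.norm_le (e.symm x)
  mem x := ⟨_, h.mem (e.symm x), rfl⟩
  fix := by
    rintro _ ⟨y, hy, rfl⟩
    change e (P (e.symm (e y))) = e y
    rw [e.symm_apply_apply, h.fix y hy]

theorem infDist_map_linearIsometryEquiv (e : G ≃ₗᵢ[ℝ] G') (H : Submodule ℝ G) (x : G) :
    Metric.infDist (e x) (H.map e.toLinearEquiv.toLinearMap : Set G') =
      Metric.infDist x (H : Set G) := by
  rw [Submodule.map_coe]
  exact Metric.infDist_image e.isometry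

theorem HasExtensions.conj {h : IsContractiveProjection P H} (hG : HasExtensions.{v, w} h)
    (e : G ≃ₗᵢ[ℝ] G') : HasExtensions.{_, w} (h.conj e) := by
  intro F _ _ _ pF A T φ hTT hTp hφT hφp hN hS ε hε
  have hd : ∀ y : G', Metric.infDist y (H.map e.toLinearEquiv.toLinearMap : Set G') =
      Metric.infDist (e.symm y) (H : Set G) := fun y => by
    rw [← infDist_map_linearIsometryEquiv e, e.apply_symm_apply]
  obtain ⟨ψ, h1, h2, h3⟩ := hG F pF A T (e.symm.toLinearEquiv.toLinearMap ∘ₗ φ) hTT hTp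
    (fun f => congrArg e.symm (hφT f))
    (fun f => by
      change e.symm (φ (pF f)) = P (e.symm (φ f))
      rw [hφp, conjProj_apply, e.symm_apply_apply])
    (fun f => by
      change ‖e.symm (φ f)‖ = _
      rw [e.symm.norm_map, hN])
    (fun f => by
      rw [← hS]
      exact (hd _).symm) ε hε
  refine ⟨e.toLinearEquiv.toLinearMap ∘ₗ ψ, fun f => ?_, fun f => ?_, fun f => ?_⟩
  · change e (ψ (T f)) = _
    rw [h1]
    exact e.apply_symm_apply _
  · change e (ψ (pF f)) = e (P (e.symm (e (ψ f))))
    rw [e.symm_apply_apply, h2]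
  · change |‖e (ψ f)‖ - _| ≤ _ ∧
      |Metric.infDist (e (ψ f)) (H.map e.toLinearEquiv.toLinearMap : Set G') - _| ≤ _
    rw [e.norm_map, infDist_map_linearIsometryEquiv]
    exact h3 f

end Transport

/-! ### The Gurarij property, by free projections. -/

section Gurarij

open ProjStr

variable {G : Type v} [NormedAddCommGroup G] [NormedSpace ℝ G] {P : G →L[ℝ] G} {H : Submodule ℝ G}

/-- The idempotent of the space generated freely by `F` and its projection. -/
def freeProj (F : Type*) [AddCommGroup F] [Module ℝ F] : F × F →ₗ[ℝ] F × F :=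
  LinearMap.inr ℝ F F ∘ₗ (LinearMap.fst ℝ F F + LinearMap.snd ℝ F F)

@[simp] theorem freeProj_apply {F : Type*} [AddCommGroup F] [Module ℝ F] (x : F × F) :
    freeProj F x = (0, x.1 + x.2) := rfl

theorem freeProj_freeProj {F : Type*} [AddCommGroup F] [Module ℝ F] (x : F × F) :
    freeProj F (freeProj F x) = freeProj F x := by simp

/-- The structure generated freely by a normed space. -/
noncomputable def freeStr (F : Type*) [NormedAddCommGroup F] [NormedSpace ℝ F] :
    ProjStr (freeProj F) where
  N := (normSeminorm ℝ F).comp (LinearMap.fst ℝ F F) + (normSeminorm ℝ F).comp (LinearMap.snd ℝ F F)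
  S := (normSeminorm ℝ F).comp (LinearMap.fst ℝ F F)
  idem := freeProj_freeProj
  N_map x := by simpa using norm_add_le x.1 x.2
  S_map x := by simp
  S_le x := le_add_of_nonneg_right (norm_nonneg _)
  N_le x := by
    simp
    linarith [norm_nonneg x.1]

variable {E F : Type*} [NormedAddCommGroup E] [NormedSpace ℝ E] [NormedAddCommGroup F]
  [NormedSpace ℝ F]

/-- The linear map induced by `φ` on the space generated freely by its domain. -/
def freeLift (P : G →L[ℝ] G) (φ : E →ₗ[ℝ] G) : E × E →ₗ[ℝ] G :=
  LinearMap.coprod φ ((P : G →ₗ[ℝ] G) ∘ₗ φ)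

@[simp] theorem freeLift_apply (P : G →L[ℝ] G) (φ : E →ₗ[ℝ] G) (x : E × E) :
    freeLift P φ x = φ x.1 + P (φ x.2) := rfl

theorem freeLift_freeProj (h : IsContractiveProjection P H) (φ : E →ₗ[ℝ] G) (x : E × E) :
    freeLift P φ (freeProj E x) = P (freeLift P φ x) := by
  simp [h.fix _ (h.mem _)]

/-- The structure generated freely by `F` over the structure of `G` on a common subspace `E`. -/
noncomputable def freeAmalgam (h : IsContractiveProjection P H) (ι : E →ₗ[ℝ] F) (φ : E →ₗ[ℝ] G) :
    ProjStr (freeProj F) :=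
  have hp : ∀ x : (F × F) × (E × E), ((freeProj F).prodMap (freeProj E))
      (((freeProj F).prodMap (freeProj E)) x) = ((freeProj F).prodMap (freeProj E)) x :=
    fun x => by simp
  marginal (q := freeProj E)
    (((ofProjection h).comap (freeLift P φ ∘ₗ LinearMap.snd ℝ (F × F) (E × E)) hp
      (fun x => freeLift_freeProj h φ x.2)).add
    ((freeStr F).comap (LinearMap.fst ℝ (F × F) (E × E) -
      (ι.prodMap ι) ∘ₗ LinearMap.snd ℝ (F × F) (E × E)) hp (fun x => by
        ext <;> simp [add_sub_add_comm])))

variable {h : IsContractiveProjection P H} {ι : E →ₗᵢ[ℝ] F} {φ : E →ₗᵢ[ℝ] G}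

theorem freeAmalgam_N_le (f g : F) (a b : E) :
    (freeAmalgam h ι.toLinearMap φ.toLinearMap).N (f, g) ≤
      ‖φ a + P (φ b)‖ + (‖f - ι a‖ + ‖g - ι b‖) :=
  Seminorm.marginal_le _ (f, g) (a, b)

theorem freeAmalgam_S_le (f g : F) (a b : E) :
    (freeAmalgam h ι.toLinearMap φ.toLinearMap).S (f, g) ≤
      (ofProjection h).S (φ a + P (φ b)) + ‖f - ι a‖ :=
  Seminorm.marginal_le _ (f, g) (a, b)

theorem norm_proj_apply_le (h : IsContractiveProjection P H) (x : G) : ‖P x‖ ≤ ‖x‖ := by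
  simpa using P.le_of_opNorm_le h.norm_le x

/-- Replacing `(a, b)` by `e` costs `‖a - e.1‖ + ‖b - e.2‖`, which dominates the resulting change of
`φ a + P (φ b)` because `φ` is isometric and `P` contractive. -/
theorem freeAmalgam_N_range (a b : E) :
    (freeAmalgam h ι.toLinearMap φ.toLinearMap).N (ι a, ι b) = ‖φ a + P (φ b)‖ := by
  refine le_antisymm (by simpa using freeAmalgam_N_le (h := h) (ι := ι) (φ := φ) (ι a) (ι b) a b) ?_
  refine Seminorm.le_marginal _ fun e => ?_
  change _ ≤ ‖φ e.1 + P (φ e.2)‖ + (‖ι a - ι e.1‖ + ‖ι b - ι e.2‖)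
  rw [← map_sub, ← map_sub, ι.norm_map, ι.norm_map]
  have h1 := norm_add₃_le (a := φ e.1 + P (φ e.2)) (b := φ (a - e.1)) (c := P (φ (b - e.2)))
  have h2 := norm_proj_apply_le h (φ (b - e.2))
  have h3 : φ e.1 + P (φ e.2) + φ (a - e.1) + P (φ (b - e.2)) = φ a + P (φ b) := by
    simp only [map_sub]
    abel
  rw [h3, φ.norm_map] at h1
  rw [φ.norm_map] at h2
  linarith

theorem freeAmalgam_S_range (a b : E) :
    (freeAmalgam h ι.toLinearMap φ.toLinearMap).S (ι a, ι b) =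
      (ofProjection h).S (φ a + P (φ b)) := by
  refine le_antisymm (by simpa using freeAmalgam_S_le (h := h) (ι := ι) (φ := φ) (ι a) (ι b) a b) ?_
  refine Seminorm.le_marginal _ fun e => ?_
  change _ ≤ (ofProjection h).S (φ e.1 + P (φ e.2)) + ‖ι a - ι e.1‖
  rw [← map_sub, ι.norm_map]
  have h1 := map_add_le_add (ofProjection h).S (φ e.1 + P (φ e.2))
    (φ (a - e.1) + P (φ (b - e.2)))
  have h2 := map_add_le_add (ofProjection h).S (φ (a - e.1)) (P (φ (b - e.2)))
  have h3 : φ e.1 + P (φ e.2) + (φ (a - e.1) + P (φ (b - e.2))) = φ a + P (φ b) := by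
    simp only [map_sub]
    abel
  have h4 : (ofProjection h).S (P (φ (b - e.2))) = 0 := (ofProjection h).S_map _
  have h5 : (ofProjection h).S (φ (a - e.1)) ≤ ‖φ (a - e.1)‖ := (ofProjection h).S_le _
  rw [h3] at h1
  rw [φ.norm_map] at h5
  linarith

/-- The norm of `F` is not shortened: `‖e.1‖ ≤ ‖φ e.1 + P (φ e.2)‖ + ‖e.2‖`, and the last term is
paid for by the second coordinate. -/
theorem freeAmalgam_N_left (f : F) :
    (freeAmalgam h ι.toLinearMap φ.toLinearMap).N (f, 0) = ‖f‖ := by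
  refine le_antisymm (by simpa using freeAmalgam_N_le (h := h) (ι := ι) (φ := φ) f 0 0 0) ?_
  refine Seminorm.le_marginal _ fun e => ?_
  change _ ≤ ‖φ e.1 + P (φ e.2)‖ + (‖f - ι e.1‖ + ‖0 - ι e.2‖)
  rw [zero_sub, norm_neg, ι.norm_map]
  have h1 := norm_sub_le (φ e.1 + P (φ e.2)) (P (φ e.2))
  have h2 := norm_proj_apply_le h (φ e.2)
  have h3 := norm_add_le (f - ι e.1) (ι e.1)
  rw [add_sub_cancel_right, φ.norm_map] at h1
  rw [φ.norm_map] at h2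
  rw [sub_add_cancel, ι.norm_map] at h3
  linarith

/-- As `F` has no projection, `(f, g)` in `F × F` plays the role of `f + P g`. The subspace is the
copy of `E × E`, and the wanted map is the restriction to the first factor. -/
theorem HasExtensions.isGurarij {G : Type u} [NormedAddCommGroup G] [NormedSpace ℝ G]
    [CompleteSpace G] [TopologicalSpace.SeparableSpace G] {P : G →L[ℝ] G} {H : Submodule ℝ G}
    {h : IsContractiveProjection P H} (hG : HasExtensions.{u, u} h) : IsGurarij G where
  complete := inferInstance
  separable := inferInstance
  extension := by
    intro E F _ _ _ _ _ _ ι φ ε hε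
    obtain ⟨R, hR⟩ := ι.toLinearMap.exists_leftInverse_of_injective
      (LinearMap.ker_eq_bot.2 ι.injective)
    have hR' : ∀ e, R (ι e) = e := LinearMap.congr_fun hR
    let T : F × F →ₗ[ℝ] F × F := (ι.toLinearMap ∘ₗ R).prodMap (ι.toLinearMap ∘ₗ R)
    have hT : ∀ x, T x = (ι (R x.1), ι (R x.2)) := fun x => rfl
    let φ' : F × F →ₗ[ℝ] G := freeLift P (φ.toLinearMap ∘ₗ R)
    have hφ' : ∀ x, φ' x = φ (R x.1) + P (φ (R x.2)) := fun x => rfl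
    obtain ⟨η, hη, hηε, hη1⟩ : ∃ η : ℝ, 0 < η ∧ η ≤ ε ∧ η < 1 :=
      ⟨min ε (1 / 2), by positivity, min_le_left _ _, (min_le_right _ _).trans_lt (by norm_num)⟩
    obtain ⟨ψ, h1, -, h3⟩ := hG (F × F) (freeProj F) (freeAmalgam h ι.toLinearMap φ.toLinearMap) T
      φ' (fun x => by simp [hT, hR']) (fun x => by simp [hT]) (fun x => by simp [hT, hφ', hR'])
      (fun x => freeLift_freeProj h _ x) (fun x => by rw [hT, freeAmalgam_N_range, hφ'])
      (fun x => by rw [hT, freeAmalgam_S_range, hφ']) η hη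
    have h4 : ∀ f, |‖(ψ ∘ₗ LinearMap.inl ℝ F F) f‖ - ‖f‖| ≤ η * ‖f‖ := fun f => by
      have := (h3 (f, 0)).1
      rw [freeAmalgam_N_left, Prod.norm_def, norm_zero, max_eq_left (norm_nonneg f)] at this
      exact this
    refine ⟨ψ ∘ₗ LinearMap.inl ℝ F F, LinearMap.injective_of_abs_norm_sub_le hη1 h4, fun e => ?_,
      IsEpsIsometry.of_abs_le hηε h4⟩
    have h5 := h1 (ι e, 0)
    rw [hT, hφ'] at h5
    simpa [hR'] using h5

end Gurarij

/-! ### Extension of morphisms: property (1). -/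

section Extension

open ProjStr

variable {G : Type v} [NormedAddCommGroup G] [NormedSpace ℝ G] {P : G →L[ℝ] G} {H : Submodule ℝ G}
  {h : IsContractiveProjection P H}

theorem HasExtensions.exists_epsMorphism (hG : HasExtensions.{v, w} h)
    {E : Type*} {F : Type w}
    [NormedAddCommGroup E] [NormedSpace ℝ E]
    [NormedAddCommGroup F] [NormedSpace ℝ F] [FiniteDimensional ℝ F]
    {E₀ : Submodule ℝ E} {PE : E →L[ℝ] E} {SE : Seminorm ℝ E}
    {F₀ : Submodule ℝ F} {PF : F →L[ℝ] F} {SF : Seminorm ℝ F}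
    {ι : E →ₗᵢ[ℝ] F} {ε : ℝ} {φ : E →ₗ[ℝ] G}
    (hPE : IsContractiveProjection PE E₀)
    (hPF : IsContractiveProjection PF F₀) (hSF : CompatibleSeminorm F₀ SF)
    (hP : ∀ x : E, PF (ι x) = ι (PE x)) (hS : ∀ x : E, SF (ι x) = SE x)
    (hε : 0 < ε) (hφ : IsEpsMorphism SE (distSeminorm H) 0 φ) (hφP : ∀ x : E, φ (PE x) = P (φ x)) :
    ∃ ψ : F →ₗ[ℝ] G, Function.Injective ψ ∧ (∀ x : E, ψ (ι x) = φ x) ∧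
      IsEpsMorphism SF (distSeminorm H) ε ψ ∧ ∀ x : F, ψ (PF x) = P (ψ x) := by
  obtain ⟨R₀, hR₀⟩ := ι.toLinearMap.exists_leftInverse_of_injective
      (LinearMap.ker_eq_bot.2 ι.injective)
  have hR₀' : ∀ e, R₀ (ι e) = e := LinearMap.congr_fun hR₀
  have hPE' : ∀ x, PE (PE x) = PE x := (ofProjection hPE).idem
  -- The left inverse must commute with the projections for the idempotent `T` to do so.
  let R : F →ₗ[ℝ] E := commPart (PE : E →ₗ[ℝ] E) (PF : F →ₗ[ℝ] F) R₀
  have hRP : ∀ x, R (PF x) = PE (R x) :=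
    commPart_comm (ofProjection hPE).idem (ofProjection hPF).idem R₀
  have hRι : ∀ e, R (ι e) = e := fun e => by
    change PE (R₀ (PF (ι e))) + (R₀ (ι e - PF (ι e)) - PE (R₀ (ι e - PF (ι e)))) = e
    rw [hP, ← map_sub, hR₀', hR₀', map_sub, hPE']
    abel
  let T : F →ₗ[ℝ] F := ι.toLinearMap ∘ₗ R
  have hT : ∀ x, T x = ι (R x) := fun x => rfl
  have hφN : ∀ e, ‖φ e‖ = ‖e‖ := fun e => by
    have := hφ.isometry e
    simp only [sub_zero, add_zero, one_mul] at this
    exact le_antisymm this.2 this.1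
  have hφS : ∀ e, distSeminorm H (φ e) = SE e := fun e => by
    have := hφ.seminorm e
    rw [zero_mul] at this
    exact (sub_eq_zero.1 (abs_nonpos_iff.1 this)).symm
  -- The factor 2 is spent on `‖f - PF f‖ ≤ 2 * SF f`; `η < 1` gives injectivity.
  obtain ⟨η, hη, hηε, hη1⟩ : ∃ η : ℝ, 0 < η ∧ 2 * η ≤ ε ∧ η < 1 :=
    ⟨min (ε / 2) (1 / 2), by positivity, by linarith [min_le_left (ε / 2) (1 / 2)],
      (min_le_right _ _).trans_lt (by norm_num)⟩
  obtain ⟨ψ, h1, h2, h3⟩ := hG F PF (ofProjection hPF) T (φ ∘ₗ R)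
    (fun f => by rw [hT, hT, hRι])
    (fun f => by
      change ι (R (PF f)) = PF (ι (R f))
      rw [hRP, hP])
    (fun f => by rw [LinearMap.comp_apply, hT, hRι, LinearMap.comp_apply])
    (fun f => by
      change φ (R (PF f)) = P (φ (R f))
      rw [hRP, hφP])
    (fun f => by rw [hT, ofProjection_N, ι.norm_map, LinearMap.comp_apply, hφN])
    (fun f => by
      change distSeminorm H (φ (R f)) = Metric.infDist (ι (R f)) (F₀ : Set F)
      rw [hφS, ← hSF, hS]) η hη
  have h4 : ∀ f, |‖ψ f‖ - ‖f‖| ≤ η * ‖f‖ := fun f => (h3 f).1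
  refine ⟨ψ, LinearMap.injective_of_abs_norm_sub_le hη1 h4, fun e => ?_,
    ⟨IsEpsIsometry.of_abs_le (by linarith) h4, fun f => ?_⟩, h2⟩
  · have := h1 (ι e)
    rwa [hT, hRι, LinearMap.comp_apply, hRι] at this
  · have h5 : ‖f - PF f‖ ≤ 2 * SF f := by
      rw [hSF]
      exact (ofProjection hPF).N_le f
    have h6 : |(ofProjection h).S (ψ f) - (ofProjection hPF).S f| ≤ η * ‖f - PF f‖ := (h3 f).2
    rw [abs_sub_comm, hSF f]
    refine h6.trans ?_
    rw [← hSF f]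
    calc η * ‖f - PF f‖ ≤ η * (2 * SF f) := by gcongr
      _ = (2 * η) * SF f := by ring
      _ ≤ ε * SF f := mul_le_mul_of_nonneg_right hηε (apply_nonneg _ _)

end Extension

theorem exists_seq_of_forall_exists {α : Type*} (Good : ℕ → α → Prop) (Rel : ℕ → α → α → Prop)
    {a₀ : α} (h₀ : Good 0 a₀)
    (hstep : ∀ n a, Good n a → ∃ b, Good (n + 1) b ∧ Rel n a b) :
    ∃ s : ℕ → α, ∀ n, Good n (s n) ∧ Rel n (s n) (s (n + 1)) := by
  choose! next h1 h2 using hstep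
  let s : ℕ → α := fun n => Nat.rec a₀ next n
  have hs : ∀ n, Good n (s n) := fun n => by
    induction n with
    | zero => exact h₀
    | succ n ih => exact h1 n _ ih
  exact ⟨s, fun n => ⟨hs n, h2 n _ (hs n)⟩⟩

/-! ### Limits of approximate isometries. -/

section Limit

variable {X G : Type*} [NormedAddCommGroup X] [NormedSpace ℝ X] [NormedAddCommGroup G]
  [NormedSpace ℝ G] [CompleteSpace G]

/-- A sequence of linear maps that are more and more isometric, and closer and closer to each
other, on an increasing sequence of subspaces with dense union converges to an isometry. -/
theorem exists_linearIsometry_of_approx {E : ℕ → Submodule ℝ X} (hE : Monotone E)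
    (hdense : Dense (⋃ n, (E n : Set X))) {f : ℕ → X →ₗ[ℝ] G} {C : ℝ}
    (hf : ∀ n, ∀ x ∈ E n, ‖f (n + 1) x - f n x‖ ≤ C / 2 ^ n * ‖x‖)
    (hi : ∀ n, ∀ x ∈ E n, |‖f n x‖ - ‖x‖| ≤ C / 2 ^ n * ‖x‖) :
    ∃ Φ : X →ₗᵢ[ℝ] G, ∀ n, ∀ x ∈ E n, Tendsto (fun k => f k x) atTop (𝓝 (Φ x)) ∧
      ‖Φ x - f n x‖ ≤ 2 * (C / 2 ^ n * ‖x‖) := by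
  have hgeom : ∀ n, ∀ x ∈ E n, ∀ k, dist (f (n + k) x) (f (n + (k + 1)) x) ≤
      2 * (C / 2 ^ n * ‖x‖) / 2 / 2 ^ k := fun n x hx k => by
    rw [dist_comm, dist_eq_norm]
    refine (hf (n + k) x (hE (Nat.le_add_right n k) hx)).trans (le_of_eq ?_)
    rw [pow_add]
    field_simp
  have hlim : ∀ n, ∀ x ∈ E n, ∃ y, Tendsto (fun k => f k x) atTop (𝓝 y) := fun n x hx => by
    obtain ⟨y, hy⟩ := cauchySeq_tendsto_of_complete (cauchySeq_of_le_geometric_two (hgeom n x hx))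
    refine ⟨y, (tendsto_add_atTop_iff_nat n).1 ?_⟩
    simpa only [add_comm] using hy
  have hmem : ∀ x : (⨆ n, E n : Submodule ℝ X), ∃ n, (x : X) ∈ E n := fun x =>
    (Submodule.mem_iSup_of_directed E hE.directed_le).1 x.2
  choose L hL using fun x : (⨆ n, E n : Submodule ℝ X) => hlim _ _ (hmem x).choose_spec
  let Λ : (⨆ n, E n : Submodule ℝ X) →ₗ[ℝ] G :=
    { toFun := L
      map_add' := fun x y => tendsto_nhds_unique (hL (x + y))
        (by simpa using (hL x).add (hL y))
      map_smul' := fun a x => tendsto_nhds_unique (hL (a • x))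
        (by simpa using (hL x).const_smul a) }
  have hnorm : ∀ x, ‖Λ x‖ = ‖(x : X)‖ := fun x => by
    obtain ⟨n, hn⟩ := hmem x
    refine tendsto_nhds_unique (hL x).norm ?_
    have h1 : Tendsto (fun k : ℕ => C / 2 ^ k * ‖(x : X)‖) atTop (𝓝 0) := by
      have h2 : Tendsto (fun k : ℕ => (1 / 2 : ℝ) ^ k) atTop (𝓝 0) :=
        tendsto_pow_atTop_nhds_zero_of_lt_one (by norm_num) (by norm_num)
      have h3 := (h2.const_mul C).mul_const ‖(x : X)‖
      simpa [div_eq_mul_inv] using h3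
    refine tendsto_iff_dist_tendsto_zero.2 (squeeze_zero' (Eventually.of_forall fun _ =>
      dist_nonneg) ?_ h1)
    filter_upwards [eventually_ge_atTop n] with k hk
    exact hi k x (hE hk hn)
  have hdr : DenseRange (⨆ n, E n : Submodule ℝ X).subtype := by
    have : Set.range (⨆ n, E n : Submodule ℝ X).subtype = ⋃ n, (E n : Set X) := by
      rw [← Submodule.coe_iSup_of_directed E hE.directed_le]
      exact Subtype.range_coe
    rw [DenseRange, this]
    exact hdense
  let Φ : X →L[ℝ] G := Λ.extendOfNorm (⨆ n, E n : Submodule ℝ X).subtype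
  have hΦ : ∀ x : (⨆ n, E n : Submodule ℝ X), Φ x = Λ x := fun x =>
    LinearMap.extendOfNorm_eq hdr ⟨1, fun y => by
      rw [one_mul, hnorm]
      rfl⟩ x
  have hΦn : ∀ x, ‖Φ x‖ = ‖x‖ := fun x =>
    hdr.induction_on x (isClosed_eq (by fun_prop) (by fun_prop)) fun y => by
      change ‖Φ y‖ = ‖(y : X)‖
      rw [hΦ, hnorm]
  refine ⟨⟨Φ, hΦn⟩, fun n x hx => ?_⟩
  have hx' : x ∈ (⨆ n, E n : Submodule ℝ X) := le_iSup E n hx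
  have ht : Tendsto (fun k => f k x) atTop (𝓝 (Φ x)) := by
    have := hL ⟨x, hx'⟩
    rwa [show Φ x = L ⟨x, hx'⟩ from hΦ ⟨x, hx'⟩]
  refine ⟨ht, ?_⟩
  have h1 := dist_le_of_le_geometric_two_of_tendsto₀ (hgeom n x hx)
    (a := Φ x) (by simpa only [add_comm] using (tendsto_add_atTop_iff_nat n).2 ht)
  rw [add_zero, dist_comm, dist_eq_norm] at h1
  exact h1

end Limit

/-! ### Universality: property (2). -/

section Universality

open ProjStr

variable {G : Type v} [NormedAddCommGroup G] [NormedSpace ℝ G] {P : G →L[ℝ] G} {H : Submodule ℝ G}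
  {h : IsContractiveProjection P H}
  {X : Type w} [NormedAddCommGroup X] [NormedSpace ℝ X] {p : X →L[ℝ] X} {X₀ : Submodule ℝ X}

/-- `φ` is, on the subspace `E`, a `δ`-morphism that commutes with the projections. -/
structure IsApproxOn (h : IsContractiveProjection P H) (hp : IsContractiveProjection p X₀)
    (E : Submodule ℝ X) (δ : ℝ) (φ : X →ₗ[ℝ] G) : Prop where
  comm : ∀ x ∈ E, φ (p x) = P (φ x)
  N : ∀ x ∈ E, |‖φ x‖ - ‖x‖| ≤ δ * ‖x‖
  S : ∀ x ∈ E, |(ofProjection h).S (φ x) - (ofProjection hp).S x| ≤ δ * (ofProjection hp).S x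

/-- The space `E`, with the pair pulled back along `φ`, is amalgamated with `E'` with error `δ`.
Extending `φ` from the first factor gives `ψ` on the second, and the cross distance in the amalgam
keeps `ψ` near `φ`. -/
theorem HasExtensions.exists_isApproxOn (hG : HasExtensions.{v, w} h)
    {hp : IsContractiveProjection p X₀} {E E' : Submodule ℝ X} [FiniteDimensional ℝ E]
    [FiniteDimensional ℝ E'] (hEE' : E ≤ E') (hE : ∀ x ∈ E, p x ∈ E) (hE' : ∀ x ∈ E', p x ∈ E')
    {δ : ℝ} (hδ : 0 ≤ δ) {φ : X →ₗ[ℝ] G} (hφ : IsApproxOn h hp E δ φ) {ε : ℝ} (hε : 0 < ε) :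
    ∃ ψ : X →ₗ[ℝ] G, IsApproxOn h hp E' ε ψ ∧ ∀ x ∈ E, ‖ψ x - φ x‖ ≤ (δ + ε) * ‖x‖ := by
  let pE : E →ₗ[ℝ] E := (p : X →ₗ[ℝ] X).restrict hE
  let pE' : E' →ₗ[ℝ] E' := (p : X →ₗ[ℝ] X).restrict hE'
  have hpp : ∀ x, p (p x) = p x := (ofProjection hp).idem
  have hpE : ∀ x, pE (pE x) = pE x := fun x => Subtype.ext (hpp x)
  have hpE' : ∀ x, pE' (pE' x) = pE' x := fun x => Subtype.ext (hpp x)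
  let A₁ : ProjStr pE := (ofProjection h).comap (φ ∘ₗ E.subtype) hpE fun x => hφ.comm x x.2
  let A₂ : ProjStr pE' := (ofProjection hp).comap E'.subtype hpE' fun x => rfl
  let c : ProjStr pE := ((ofProjection hp).comap E.subtype hpE fun x => rfl).smul ⟨δ, hδ⟩
  have hclose : Close A₁ A₂ c LinearMap.id (Submodule.inclusion hEE') :=
    ⟨fun _ => rfl, fun _ => rfl, fun x => hφ.N x x.2, fun x => hφ.S x x.2⟩
  have hε2 : 0 < ε / 2 := half_pos hε
  obtain ⟨ψ, h1, h2, h3⟩ := hG (E × E') (pE.prodMap pE') (amalgam hclose)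
    (LinearMap.inl ℝ E E' ∘ₗ LinearMap.fst ℝ E E') (φ ∘ₗ E.subtype ∘ₗ LinearMap.fst ℝ E E')
    (fun _ => rfl) (fun _ => by simp) (fun _ => rfl) (fun x => hφ.comm x.1 x.1.2)
    (fun x => (amalgam_N_left hclose x.1).symm) (fun x => (amalgam_S_left hclose x.1).symm) _ hε2
  obtain ⟨ψ', hψ'⟩ := (ψ ∘ₗ LinearMap.inr ℝ E E').exists_extend
  have hψ : ∀ x (hx : x ∈ E'), ψ' x = ψ (0, ⟨x, hx⟩) := fun x hx =>
    LinearMap.congr_fun hψ' ⟨x, hx⟩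
  refine ⟨ψ', ⟨fun x hx => ?_, fun x hx => ?_, fun x hx => ?_⟩, fun x hx => ?_⟩
  · rw [hψ x hx, hψ _ (hE' x hx), ← h2, LinearMap.prodMap_apply, map_zero]
    rfl
  · have h4 := (h3 (0, ⟨x, hx⟩)).1
    rw [amalgam_N_right, Prod.norm_def, norm_zero, max_eq_right (norm_nonneg _)] at h4
    rw [hψ x hx]
    exact h4.trans (mul_le_mul_of_nonneg_right (by linarith) (norm_nonneg _))
  · have h4 := (h3 (0, ⟨x, hx⟩)).2
    rw [amalgam_S_right, LinearMap.prodMap_apply, map_zero, Prod.mk_sub_mk, sub_self,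
      Prod.norm_def, norm_zero, max_eq_right (norm_nonneg _)] at h4
    rw [hψ x hx]
    have h5 : ‖x - p x‖ ≤ 2 * (ofProjection hp).S x := (ofProjection hp).N_le x
    refine h4.trans ?_
    calc ε / 2 * ‖x - p x‖ ≤ ε / 2 * (2 * (ofProjection hp).S x) := by gcongr
      _ = ε * (ofProjection hp).S x := by ring
  · have h4 := (abs_le.1 (h3 (-⟨x, hx⟩, ⟨x, hEE' hx⟩)).1).2
    have h5 : (amalgam hclose).N (-⟨x, hx⟩, ⟨x, hEE' hx⟩) ≤ δ * ‖x‖ := by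
      have := amalgam_N_cross hclose (-⟨x, hx⟩)
      rw [map_neg_eq_map c.N, LinearMap.id_apply, map_neg, neg_neg] at this
      exact this
    have h6 : ψ (-⟨x, hx⟩, ⟨x, hEE' hx⟩) = ψ' x - φ x := by
      have h7 : ψ (⟨x, hx⟩, 0) = φ x := h1 (⟨x, hx⟩, 0)
      rw [hψ x (hEE' hx), ← h7, ← map_sub, Prod.mk_sub_mk, zero_sub, sub_zero]
    have h8 : ‖((-⟨x, hx⟩, ⟨x, hEE' hx⟩) : E × E')‖ = ‖x‖ := by
      rw [Prod.norm_def, norm_neg]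
      exact max_self _
    rw [h6, h8] at h4
    have h9 : 0 ≤ ε * ‖x‖ := by positivity
    linarith

theorem HasExtensions.exists_linearIsometry [CompleteSpace G] (hG : HasExtensions.{v, w} h)
    [TopologicalSpace.SeparableSpace X] (hp : IsContractiveProjection p X₀) :
    ∃ φ : X →ₗᵢ[ℝ] G, ∀ x : X,
      Metric.infDist x (X₀ : Set X) = Metric.infDist (φ x) (H : Set G) ∧ P (φ x) = φ (p x) := by
  let x : ℕ → X := TopologicalSpace.denseSeq X
  let s : ℕ → Set X := fun n => x '' Set.Iio n ∪ (fun i => p (x i)) '' Set.Iio n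
  have hsmono : Monotone s := fun m n hmn =>
    Set.union_subset_union (Set.image_mono (Set.Iio_subset_Iio hmn))
      (Set.image_mono (Set.Iio_subset_Iio hmn))
  let E : ℕ → Submodule ℝ X := fun n => Submodule.span ℝ (s n)
  -- The spaces also contain the points `p (x i)`, hence are invariant under `p`; `E 0` is zero, so
  -- the zero map starts the recursion.
  have hE : Monotone E := fun m n hmn => Submodule.span_mono (hsmono hmn)
  have hfin : ∀ n, FiniteDimensional ℝ (E n) := fun n =>
    FiniteDimensional.span_of_finite ℝ (((Set.finite_Iio n).image _).union
      ((Set.finite_Iio n).image _))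
  have hpE : ∀ n, ∀ y ∈ E n, p y ∈ E n := fun n y hy => by
    have : E n ≤ (E n).comap (p : X →ₗ[ℝ] X) := by
      refine Submodule.span_le.2 ?_
      rintro _ (⟨i, hi, rfl⟩ | ⟨i, hi, rfl⟩)
      · exact Submodule.subset_span (Or.inr ⟨i, hi, rfl⟩)
      · refine Submodule.subset_span (Or.inr ⟨i, hi, ?_⟩)
        exact ((ofProjection hp).idem (x i)).symm
    exact this hy
  have hdense : Dense (⋃ n, (E n : Set X)) := by
    refine (TopologicalSpace.denseRange_denseSeq X).mono ?_
    rintro _ ⟨i, rfl⟩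
    exact Set.mem_iUnion.2 ⟨i + 1, Submodule.subset_span (Or.inl ⟨i, Nat.lt_succ_self i, rfl⟩)⟩
  have hpos : ∀ n : ℕ, (0 : ℝ) < 1 / 2 ^ n := fun n => by positivity
  have h0 : IsApproxOn h hp (E 0) (1 / 2 ^ 0) (0 : X →ₗ[ℝ] G) := by
    have hs0 : s 0 = ∅ := by
      simp [s]
    have hE0 : ∀ y ∈ E 0, y = 0 := fun y hy => by
      have hy' : y ∈ Submodule.span ℝ (s 0) := hy
      rw [hs0, Submodule.span_empty] at hy'
      exact (Submodule.mem_bot ℝ).1 hy'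
    refine ⟨fun y _ => by simp, fun y hy => ?_, fun y hy => ?_⟩
    · rw [hE0 y hy]
      simp
    · rw [hE0 y hy, LinearMap.zero_apply, map_zero, map_zero]
      simp
  obtain ⟨f, hf⟩ := exists_seq_of_forall_exists
    (Good := fun n φ => IsApproxOn h hp (E n) (1 / 2 ^ n) φ)
    (Rel := fun n φ ψ => ∀ y ∈ E n, ‖ψ y - φ y‖ ≤ (1 / 2 ^ n + 1 / 2 ^ (n + 1)) * ‖y‖) h0
    (fun n φ hφ => hG.exists_isApproxOn (hE (Nat.le_succ n)) (hpE n) (hpE (n + 1)) (hpos n).le hφ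
      (hpos (n + 1)))
  obtain ⟨Φ, hΦ⟩ := exists_linearIsometry_of_approx hE hdense (f := f) (C := 2)
    (fun n y hy => ((hf n).2 y hy).trans (mul_le_mul_of_nonneg_right (by
      rw [pow_succ]
      field_simp
      norm_num) (norm_nonneg y)))
    (fun n y hy => ((hf n).1.N y hy).trans (mul_le_mul_of_nonneg_right (by gcongr; norm_num)
      (norm_nonneg y)))
  have hall : ∀ y : X, Metric.infDist y (X₀ : Set X) = Metric.infDist (Φ y) (H : Set G) ∧
      P (Φ y) = Φ (p y) := fun y => by
    refine hdense.induction (P := fun y => Metric.infDist y (X₀ : Set X) =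
      Metric.infDist (Φ y) (H : Set G) ∧ P (Φ y) = Φ (p y)) (fun z hz => ?_) ?_ y
    · obtain ⟨n, hn⟩ := Set.mem_iUnion.1 hz
      have h1 := (hΦ n z hn).1
      have h2 := (hΦ n (p z) (hpE n z hn)).1
      refine ⟨?_, ?_⟩
      · have h3 : Tendsto (fun k => Metric.infDist (f k z) (H : Set G)) atTop
            (𝓝 (Metric.infDist (Φ z) (H : Set G))) :=
          ((Metric.continuous_infDist_pt _).tendsto _).comp h1
        refine tendsto_nhds_unique ?_ h3
        have h4 : Tendsto (fun k : ℕ => 1 / 2 ^ k * Metric.infDist z (X₀ : Set X)) atTop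
            (𝓝 0) := by
          have h5 : Tendsto (fun k : ℕ => (1 / 2 : ℝ) ^ k) atTop (𝓝 0) :=
            tendsto_pow_atTop_nhds_zero_of_lt_one (by norm_num) (by norm_num)
          simpa using h5.mul_const (Metric.infDist z (X₀ : Set X))
        refine tendsto_iff_dist_tendsto_zero.2 (squeeze_zero' (Eventually.of_forall fun _ =>
          dist_nonneg) ?_ h4)
        filter_upwards [eventually_ge_atTop n] with k hk
        exact (hf k).1.S z (hE hk hn)
      · refine tendsto_nhds_unique ((P.continuous.tendsto _).comp h1) (h2.congr' ?_)
        filter_upwards [eventually_ge_atTop n] with k hk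
        exact (hf k).1.comm z (hE hk hn)
    · exact (isClosed_eq (Metric.continuous_infDist_pt _)
        ((Metric.continuous_infDist_pt _).comp Φ.continuous)).inter
        (isClosed_eq (P.continuous.comp Φ.continuous) (Φ.continuous.comp p.continuous))
  exact ⟨Φ, hall⟩

end Universality

/-! ### Uniqueness of the Gurarij space, by back-and-forth. -/

section Uniqueness

/-- Amalgams carry only seminorms, so one passes to the separation quotient; `φ` factors through it
because it kills whatever `N ∘ ι` kills. -/
theorem IsGurarij.exists_extension {G : Type u} [NormedAddCommGroup G] [NormedSpace ℝ G]
    (hG : IsGurarij G) {V : Type u} [AddCommGroup V] [Module ℝ V] [FiniteDimensional ℝ V]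
    {U : Type*} [AddCommGroup U] [Module ℝ U] (N : Seminorm ℝ V) {ι : U →ₗ[ℝ] V} {φ : U →ₗ[ℝ] G}
    (hφ : ∀ x, ‖φ x‖ = N (ι x)) {ε : ℝ} (hε : 0 < ε) :
    ∃ ψ : V →ₗ[ℝ] G, (∀ x, ψ (ι x) = φ x) ∧ ∀ x, |‖ψ x‖ - N x| ≤ ε * N x := by
  let Q := SeparationQuotient (WithSeminorm N)
  let π : V →ₗ[ℝ] Q := (SeparationQuotient.mkCLM ℝ (WithSeminorm N)).toLinearMap ∘ₗ
    (WithSeminorm.of N).toLinearMap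
  have hπ : ∀ x, ‖π x‖ = N x := fun x => SeparationQuotient.norm_mk (WithSeminorm.of N x)
  have hsurj : Function.Surjective π :=
    SeparationQuotient.surjective_mk.comp (WithSeminorm.of N).surjective
  have : FiniteDimensional ℝ Q := Module.Finite.of_surjective π hsurj
  obtain ⟨s, hs⟩ := (π ∘ₗ ι).rangeRestrict.exists_rightInverse_of_surjective
    (LinearMap.range_rangeRestrict _)
  have hs' : ∀ q : (π ∘ₗ ι).range, π (ι (s q)) = q := fun q =>
    congrArg Subtype.val (LinearMap.congr_fun hs q)
  let φ' : (π ∘ₗ ι).range →ₗᵢ[ℝ] G :=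
    { toLinearMap := φ ∘ₗ s
      norm_map' := fun q => by
        rw [LinearMap.comp_apply, hφ, ← hπ, hs']
        rfl }
  obtain ⟨ψ, -, hψ, hψε⟩ := hG.extension _ Q (π ∘ₗ ι).range.subtypeₗᵢ φ' ε hε
  refine ⟨ψ ∘ₗ π, fun x => ?_, fun x => ?_⟩
  · have h1 := hψ ⟨π (ι x), x, rfl⟩
    refine h1.trans ?_
    change φ (s _) = φ x
    rw [← sub_eq_zero, ← map_sub, ← norm_eq_zero, hφ, ← hπ, map_sub, map_sub, hs', sub_self,
      norm_zero]
  · have := hψε (π x)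
    rw [hπ] at this
    rw [abs_le]
    constructor
    · change _ ≤ ‖ψ (π x)‖ - N x
      linarith
    · change ‖ψ (π x)‖ - N x ≤ _
      linarith

variable {G G' : Type u} [NormedAddCommGroup G] [NormedSpace ℝ G] [NormedAddCommGroup G']
  [NormedSpace ℝ G']

-- The spaces `E` and `F` are amalgamated along `f` with error `δ * ‖x‖`, using the identity as
-- idempotent and `S = 0`. The inclusion of `E` extends to the amalgam, and its restriction to `F`
-- is `g`.
open ProjStr in
theorem IsGurarij.exists_almost_inverse (hG : IsGurarij G) {E : Submodule ℝ G} {F : Submodule ℝ G'}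
    [FiniteDimensional ℝ E] [FiniteDimensional ℝ F] {f : G →ₗ[ℝ] G'} (hEF : ∀ x ∈ E, f x ∈ F)
    {δ : ℝ} (hδ : 0 ≤ δ) (hf : ∀ x ∈ E, |‖f x‖ - ‖x‖| ≤ δ * ‖x‖) {ε : ℝ} (hε : 0 < ε) :
    ∃ g : G' →ₗ[ℝ] G, (∀ y ∈ F, |‖g y‖ - ‖y‖| ≤ ε * ‖y‖) ∧
      ∀ x ∈ E, ‖g (f x) - x‖ ≤ (1 + ε) * (δ * ‖x‖) := by
  let c := (ofSeminorm (normSeminorm ℝ E)).smul ⟨δ, hδ⟩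
  have h : Close (ofSeminorm (normSeminorm ℝ E)) (ofSeminorm (normSeminorm ℝ F)) c LinearMap.id
      (f.restrict hEF) :=
    { left := fun _ => rfl
      right := fun _ => rfl
      N := fun x => by
        rw [abs_sub_comm]
        exact hf x x.2
      S := fun x => by
        change |(0 : ℝ) - 0| ≤ δ * 0
        simp }
  obtain ⟨ψ, h1, h2⟩ := hG.exists_extension (amalgam h).N (ι := LinearMap.inl ℝ E F)
    (φ := E.subtype) (fun x => (amalgam_N_left h x).symm) hε
  obtain ⟨g, hg⟩ := (ψ ∘ₗ LinearMap.inr ℝ E F).exists_extend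
  have hg' : ∀ y (hy : y ∈ F), g y = ψ (0, ⟨y, hy⟩) := fun y hy => LinearMap.congr_fun hg ⟨y, hy⟩
  refine ⟨g, fun y hy => ?_, fun x hx => ?_⟩
  · rw [hg' y hy]
    have h3 := h2 (0, ⟨y, hy⟩)
    rw [amalgam_N_right] at h3
    exact h3
  · have h3 := (abs_le.1 (h2 (-⟨x, hx⟩, ⟨f x, hEF x hx⟩))).2
    have h4 : (amalgam h).N (-⟨x, hx⟩, ⟨f x, hEF x hx⟩) ≤ δ * ‖x‖ := by
      have := amalgam_N_cross h (-⟨x, hx⟩)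
      rw [map_neg_eq_map c.N, LinearMap.id_apply, map_neg, neg_neg] at this
      exact this
    have h5 : ψ (-⟨x, hx⟩, ⟨f x, hEF x hx⟩) = g (f x) - x := by
      have h6 : ψ (⟨x, hx⟩, 0) = x := h1 ⟨x, hx⟩
      have h7 : ψ (-⟨x, hx⟩, ⟨f x, hEF x hx⟩) = ψ (0, ⟨f x, hEF x hx⟩) - ψ (⟨x, hx⟩, 0) := by
        rw [← map_sub, Prod.mk_sub_mk, zero_sub, sub_zero]
      rw [h7, h6, hg' _ (hEF x hx)]
    rw [h5] at h3
    have h7 := mul_le_mul_of_nonneg_left h4 (by linarith : 0 ≤ 1 + ε)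
    linarith

/-- One step of the back-and-forth construction. -/
theorem IsGurarij.exists_back_and_forth (hG : IsGurarij G) (hG' : IsGurarij G') (a : ℕ → G)
    (b : ℕ → G') (n : ℕ) {E : Submodule ℝ G} [FiniteDimensional ℝ E] {f : G →ₗ[ℝ] G'}
    {δ : ℝ} (hδ : 0 < δ) (hδ1 : δ ≤ 1) (hf : ∀ x ∈ E, |‖f x‖ - ‖x‖| ≤ δ * ‖x‖) :
    ∃ (E' : Submodule ℝ G) (f' : G →ₗ[ℝ] G'), FiniteDimensional ℝ E' ∧
      (∀ x ∈ E', |‖f' x‖ - ‖x‖| ≤ δ / 2 * ‖x‖) ∧ E ≤ E' ∧ a n ∈ E' ∧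
      (∀ x ∈ E, ‖f' x - f x‖ ≤ 6 * δ * ‖x‖) ∧
      ∀ i ≤ n, ∃ z ∈ E', ‖z‖ ≤ 2 * ‖b i‖ ∧ ‖f' z - b i‖ ≤ δ * ‖b i‖ := by
  have hfin : ∀ s : Set G', s.Finite → FiniteDimensional ℝ (Submodule.span ℝ s) := fun s hs =>
    FiniteDimensional.span_of_finite ℝ hs
  let F : Submodule ℝ G' := E.map f ⊔ Submodule.span ℝ (b '' Set.Iic n)
  have := hfin _ ((Set.finite_Iic n).image b)
  have hδ2 : 0 < δ / 2 := half_pos hδ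
  have hEF : ∀ x ∈ E, f x ∈ F := fun x hx =>
    Submodule.mem_sup_left (Submodule.mem_map_of_mem hx)
  obtain ⟨g, hg, hgf⟩ := hG.exists_almost_inverse (F := F) hEF hδ.le hf hδ2
  let E' : Submodule ℝ G := E ⊔ F.map g ⊔ Submodule.span ℝ {a n}
  have hFE : ∀ y ∈ F, g y ∈ E' := fun y hy =>
    Submodule.mem_sup_left (Submodule.mem_sup_right (Submodule.mem_map_of_mem hy))
  have hEE' : E ≤ E' := le_sup_left.trans le_sup_left
  obtain ⟨f', hf', hfg⟩ := hG'.exists_almost_inverse (F := E') hFE hδ2.le hg hδ2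
  have hbF : ∀ i ≤ n, b i ∈ F := fun i hi =>
    Submodule.mem_sup_right (Submodule.subset_span ⟨i, hi, rfl⟩)
  have hle : ∀ t : ℝ, 0 ≤ t → δ * t ≤ t := fun t ht => by
    simpa using mul_le_mul_of_nonneg_right hδ1 ht
  have hquad : ∀ t : ℝ, 0 ≤ t → (1 + δ / 2) * (δ * t) ≤ 2 * (δ * t) := fun t ht =>
    mul_le_mul_of_nonneg_right (by linarith) (by positivity)
  refine ⟨E', f', inferInstance, hf', hEE', Submodule.mem_sup_right
    (Submodule.mem_span_singleton_self _), fun x hx => ?_, fun i hi => ⟨g (b i), hFE _ (hbF i hi),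
      ?_, ?_⟩⟩
  · have h1 := hgf x hx
    have h2 := hfg (f x) (hEF x hx)
    have hmem : x - g (f x) ∈ E' := E'.sub_mem (hEE' hx) (hFE _ (hEF x hx))
    have h3 := (abs_le.1 (hf' _ hmem)).2
    have h4 := norm_sub_rev x (g (f x))
    have h5 := (abs_le.1 (hf x hx)).2
    -- The two terms are at most `3 * δ * ‖x‖` and `2 * δ * ‖x‖`, so the constant 6 has room to
    -- spare.
    have h6 : f' x - f x = f' (x - g (f x)) + (f' (g (f x)) - f x) := by
      rw [map_sub]
      abel
    have h7 := norm_add_le (f' (x - g (f x))) (f' (g (f x)) - f x)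
    rw [← h6] at h7
    have h8 := hle ‖x‖ (norm_nonneg x)
    have h9 := hquad ‖x‖ (norm_nonneg x)
    have h10 := hquad ‖f x‖ (norm_nonneg _)
    have h11 : δ * ‖f x‖ ≤ δ * (2 * ‖x‖) := mul_le_mul_of_nonneg_left (by linarith) hδ.le
    have h12 := hle ‖x - g (f x)‖ (norm_nonneg _)
    have h13 : (1 + δ / 2) * (δ / 2 * ‖f x‖) = ((1 + δ / 2) * (δ * ‖f x‖)) / 2 := by ring
    have h14 := norm_nonneg (x - g (f x))
    linarith
  · have h1 := (abs_le.1 (hg _ (hbF i hi))).2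
    have h2 := hle ‖b i‖ (norm_nonneg _)
    linarith [norm_nonneg (b i)]
  · have h1 := hfg _ (hbF i hi)
    have h2 := hquad ‖b i‖ (norm_nonneg _)
    linarith

/-- Any two Gurarij spaces are linearly isometric. -/
theorem IsGurarij.nonempty_linearIsometryEquiv (hG : IsGurarij G) (hG' : IsGurarij G') :
    Nonempty (G ≃ₗᵢ[ℝ] G') := by
  have := hG.complete
  have := hG'.complete
  have := hG.separable
  have := hG'.separable
  let a : ℕ → G := TopologicalSpace.denseSeq G
  let b : ℕ → G' := TopologicalSpace.denseSeq G'
  obtain ⟨s, hs⟩ := exists_seq_of_forall_exists (α := Submodule ℝ G × (G →ₗ[ℝ] G'))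
    (Good := fun n t => FiniteDimensional ℝ t.1 ∧ ∀ x ∈ t.1, |‖t.2 x‖ - ‖x‖| ≤ 1 / 2 ^ n * ‖x‖)
    (Rel := fun n t t' => t.1 ≤ t'.1 ∧ a n ∈ t'.1 ∧
      (∀ x ∈ t.1, ‖t'.2 x - t.2 x‖ ≤ 6 * (1 / 2 ^ n) * ‖x‖) ∧
      -- Old points are matched anew at each step, so each `b i` is approximated with errors tending
      -- to zero.
      ∀ i ≤ n, ∃ z ∈ t'.1, ‖z‖ ≤ 2 * ‖b i‖ ∧ ‖t'.2 z - b i‖ ≤ 1 / 2 ^ n * ‖b i‖)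
    (a₀ := (⊥, 0))
    ⟨inferInstance, fun x hx => by
      rw [(Submodule.mem_bot ℝ).1 hx]
      simp⟩
    (fun n t ht => by
      have := ht.1
      obtain ⟨E', f', h1, h2, h3⟩ := hG.exists_back_and_forth hG' a b n (by positivity)
        ((div_le_one (by positivity)).2 (one_le_pow₀ (by norm_num))) ht.2
      refine ⟨(E', f'), ⟨h1, fun x hx => (h2 x hx).trans (le_of_eq ?_)⟩, h3⟩
      rw [pow_succ]
      field_simp)
  have hE : Monotone fun n => (s n).1 := monotone_nat_of_le_succ fun n => (hs n).2.1
  have hdense : Dense (⋃ n, ((s n).1 : Set G)) := by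
    refine (TopologicalSpace.denseRange_denseSeq G).mono ?_
    rintro _ ⟨i, rfl⟩
    exact Set.mem_iUnion.2 ⟨i + 1, (hs i).2.2.1⟩
  obtain ⟨Φ, hΦ⟩ := exists_linearIsometry_of_approx hE hdense (f := fun n => (s n).2) (C := 6)
    (fun n x hx => by
      have := (hs n).2.2.2.1 x hx
      rwa [mul_one_div] at this)
    (fun n x hx => ((hs n).1.2 x hx).trans (mul_le_mul_of_nonneg_right (by gcongr; norm_num)
      (norm_nonneg x)))
  have hclosed : IsClosed (Set.range Φ) := Φ.isometry.isClosedEmbedding.isClosed_range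
  have hsurj : Function.Surjective Φ := by
    rw [← Set.range_eq_univ, ← hclosed.closure_eq, ← dense_iff_closure_eq, ← dense_closure]
    refine (TopologicalSpace.denseRange_denseSeq G').mono ?_
    rintro _ ⟨i, rfl⟩
    change b i ∈ _
    refine Metric.mem_closure_iff.2 fun ε hε => ?_
    -- The 13 is 12 from passing to the limit map, as `‖z‖ ≤ 2 * ‖b i‖`, plus 1 from the match at
    -- step `n`.
    have ht : Tendsto (fun k : ℕ => 13 * ‖b i‖ * (1 / 2 : ℝ) ^ k) atTop (𝓝 0) := by
      simpa using (tendsto_pow_atTop_nhds_zero_of_lt_one (r := (1 / 2 : ℝ)) (by norm_num)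
        (by norm_num)).const_mul (13 * ‖b i‖)
    obtain ⟨n, hn, hin⟩ := ((ht.eventually (gt_mem_nhds hε)).and (eventually_ge_atTop i)).exists
    obtain ⟨z, hz, hz1, hz2⟩ := (hs n).2.2.2.2 i hin
    refine ⟨Φ z, ⟨z, rfl⟩, lt_of_le_of_lt ?_ hn⟩
    have h1 := (hΦ (n + 1) z hz).2
    have h2 := norm_sub_le_norm_sub_add_norm_sub (Φ z) ((s (n + 1)).2 z) (b i)
    have h3 : (6 : ℝ) / 2 ^ (n + 1) * ‖z‖ ≤ 6 / 2 ^ (n + 1) * (2 * ‖b i‖) := by gcongr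
    have h4 : (6 : ℝ) / 2 ^ (n + 1) * (2 * ‖b i‖) = 6 * ‖b i‖ * (1 / 2 : ℝ) ^ n := by
      rw [pow_succ, one_div_pow]
      field_simp
    have h5 : 1 / 2 ^ n * ‖b i‖ = ‖b i‖ * (1 / 2 : ℝ) ^ n := by
      rw [one_div_pow, mul_comm]
    rw [dist_comm, dist_eq_norm]
    linarith
  exact ⟨LinearIsometryEquiv.ofSurjective Φ hsurj⟩

end Uniqueness

/-! ### Assembly. -/

theorem exists_hasExtensions : ∃ (G : Type u) (_ : NormedAddCommGroup G) (_ : NormedSpace ℝ G)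
    (P : G →L[ℝ] G) (H : Submodule ℝ G) (h : IsContractiveProjection P H),
    IsGurarij G ∧ HasExtensions.{u, u} h := by
  obtain ⟨X, hX⟩ := PlaneSeq.exists_isGeneric
  -- The completion lives in the lowest universe and is lifted to `u`.
  let e : PlaneSeq.Compl X ≃ₗᵢ[ℝ] ULift.{u} (PlaneSeq.Compl X) :=
    (LinearIsometryEquiv.ulift ℝ (PlaneSeq.Compl X)).symm
  have hext := (PlaneSeq.IsGeneric.hasExtensions.{u} hX).conj e
  have := PlaneSeq.separableSpace_compl X
  have : TopologicalSpace.SeparableSpace (ULift.{u} (PlaneSeq.Compl X)) :=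
    e.surjective.denseRange.separableSpace e.continuous
  exact ⟨_, _, _, _, _, _, hext.isGurarij, hext⟩

theorem IsGurarij.exists_hasExtensions {G : Type u} [NormedAddCommGroup G] [NormedSpace ℝ G]
    (hG : IsGurarij G) : ∃ (H : Submodule ℝ G) (P : G →L[ℝ] G) (h : IsContractiveProjection P H),
    HasExtensions.{u, u} h := by
  obtain ⟨G', _, _, P, H, h, hG', hext⟩ := _root_.exists_hasExtensions.{u}
  obtain ⟨e⟩ := hG'.nonempty_linearIsometryEquiv hG
  exact ⟨_, _, h.conj e, hext.conj e⟩

/-- The line with its identity projection embeds, and its image consists of vectors fixed by `P`. -/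
theorem HasExtensions.norm_eq_one {G : Type u} [NormedAddCommGroup G] [NormedSpace ℝ G]
    [CompleteSpace G] {P : G →L[ℝ] G} {H : Submodule ℝ G} {h : IsContractiveProjection P H}
    (hG : HasExtensions.{u, u} h) : ‖P‖ = 1 := by
  have hid : IsContractiveProjection (ContinuousLinearMap.id ℝ (ULift.{u} ℝ)) ⊤ :=
    ⟨ContinuousLinearMap.norm_id_le, fun _ => trivial, fun _ _ => rfl⟩
  have : TopologicalSpace.SeparableSpace (ULift.{u} ℝ) :=
    (ULift.up_surjective (α := ℝ)).denseRange.separableSpace continuous_uliftUp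
  obtain ⟨φ, hφ⟩ := hG.exists_linearIsometry hid
  refine le_antisymm h.norm_le ?_
  have h1 := P.le_opNorm (φ (ULift.up 1))
  rw [(hφ _).2, ContinuousLinearMap.id_apply, φ.norm_map] at h1
  have h2 : ‖(ULift.up 1 : ULift.{u} ℝ)‖ = 1 := by simp [ULift.norm_def]
  rwa [h2, mul_one] at h1

theorem mainTheorem8 :
    (∃ (G : Type u) (_ : NormedAddCommGroup G) (_ : NormedSpace ℝ G), IsGurarij G) ∧
    ∀ (G : Type u) [NormedAddCommGroup G] [NormedSpace ℝ G], IsGurarij G →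
      ∃ (H : Submodule ℝ G) (P : G →L[ℝ] G), IsContractiveProjection P H ∧ ‖P‖ = 1 ∧
        (∀ (E F : Type u)
          [NormedAddCommGroup E] [NormedSpace ℝ E] [FiniteDimensional ℝ E]
          [NormedAddCommGroup F] [NormedSpace ℝ F] [FiniteDimensional ℝ F]
          (E₀ : Submodule ℝ E) (PE : E →L[ℝ] E) (SE : Seminorm ℝ E)
          (F₀ : Submodule ℝ F) (PF : F →L[ℝ] F) (SF : Seminorm ℝ F)
          (ι : E →ₗᵢ[ℝ] F) (ε : ℝ) (φ : E →ₗ[ℝ] G),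
          IsContractiveProjection PE E₀ → CompatibleSeminorm E₀ SE →
          IsContractiveProjection PF F₀ → CompatibleSeminorm F₀ SF →
          (∀ x : E, PF (ι x) = ι (PE x)) → (∀ x : E, SF (ι x) = SE x) →
          0 < ε →
          IsEpsMorphism SE (distSeminorm H) 0 φ → (∀ x : E, φ (PE x) = P (φ x)) →
          ∃ ψ : F →ₗ[ℝ] G, Function.Injective ψ ∧ (∀ x : E, ψ (ι x) = φ x) ∧
            IsEpsMorphism SF (distSeminorm H) ε ψ ∧ ∀ x : F, ψ (PF x) = P (ψ x)) ∧
        (∀ (X : Type u) [NormedAddCommGroup X] [NormedSpace ℝ X] [CompleteSpace X]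
          [TopologicalSpace.SeparableSpace X] (X₀ : Submodule ℝ X) (p : X →L[ℝ] X),
          IsContractiveProjection p X₀ →
          ∃ φ : X →ₗᵢ[ℝ] G, ∀ x : X,
            Metric.infDist x (X₀ : Set X) = Metric.infDist (φ x) (H : Set G) ∧
            P (φ x) = φ (p x)) := by
  refine ⟨?_, fun G _ _ hG => ?_⟩
  · obtain ⟨G, i, j, -, -, -, hG, -⟩ := exists_hasExtensions.{u}
    exact ⟨G, i, j, hG⟩
  · have := hG.complete
    obtain ⟨H, P, h, hext⟩ := hG.exists_hasExtensions
    refine ⟨H, P, h, hext.norm_eq_one, ?_, ?_⟩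
    · intro E F _ _ _ _ _ _ E₀ PE SE F₀ PF SF ι ε φ hPE _ hPF hSF hP hS hε hφ hφP
      exact hext.exists_epsMorphism hPE hPF hSF hP hS hε hφ hφP
    · intro X _ _ _ _ X₀ p hp
      exact hext.exists_linearIsometry hp
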